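/- Let $M,N\ge 1$ be integers, write points of $\mathbb R^{M+N}$ as $x=(\mathbf v,\mathbf w)$ with $\mathbf v\in\mathbb R^M$, $\mathbf w\in\mathbb R^N$, and let $\sigma$ be the normalized uniform measure on the sphere $\mathbb S=\mathbb S^{M+N-1}(\sqrt{M+N})$ of radius $\sqrt{M+N}$ in $\mathbb R^{M+N}$. Let $\nu$ be a probability measure on angles (on the circle, or on $\mathbb R$) with $\int \nu(d\theta)\sin\theta\cos\theta=0$. For $i\neq j$ let $r_{ij}(\theta)$ be the rotation for which $r_{ij}(\theta)^{-1}x$ has $i$-th coordinate $x_i\cos\theta-x_j\sin\theta$, $j$-th coordinate $x_i\sin\theta+x_j\cos\theta$ and the same other coordinates as $x$, and let $(R_{ij}F)(x)=\int\nu(d\theta)\,F(r_{ij}(\theta)^{-1}x)$ on $L^1(\mathbb S,\sigma)$. For rates $\lambda_S,\lambda_R,\mu\ge 0$ let $$\mathcal L=\frac{\lambda_S}{M-1}\sum_{1\le i<j\le M}(R_{ij}-I)+\frac{\lambda_R}{N-1}\sum_{M<i<j\le M+N}(R_{ij}-I)+\frac{\mu}{N}\sum_{i=1}^{M}\sum_{j=M+1}^{M+N}(R_{ij}-I),$$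 a bounded operator on $L^1(\mathbb S,\sigma)$ (the first sum is absent if $M=1$, the second if $N=1$), and let $e^{\mathcal L t}$ be the semigroup that it generates. Let $\mathcal N F(\mathbf v,\mathbf w)=\int_{SO(N)}F(\mathbf v,S^{-1}\mathbf w)\,dS$, with the normalized Haar measure $dS$ on $SO(N)$. For $0\le F\in L^1(\mathbb S,\sigma)$ let $$I(F)=\int_{\mathbb S}\frac{|\nabla F|^2}{F}\,d\sigma\in[0,\infty],$$ where $\nabla F$ is the weak gradient on $\mathbb S$, $|\cdot|$ is the length in the metric of $\mathbb S$, the integrand is $0$ where $\nabla F=0$, and $I(F)=\infty$ if $F$ has no integrable weak gradient. Put $\mu_\nu=\mu\int\nu(d\theta)\sin^2\theta$. Let $F_0\in L^1(\mathbb S,\sigma)$ be nonnegative (for instance a probability density) and invariant under all rotations that fix $\mathbf v$, that is, $F_0(\mathbf v,S\mathbf w)=F_0(\mathbf v,\mathbf w)$ for all $S\in SO(N)$. Then for all $t\ge 0$ $$I(\mathcal N e^{\mathcal L t}F_0)\le\left[2\left(\frac{M}{M+N}+e^{-\mu_\nu\frac{M+N}{N}t}\,\frac{N}{M+N}\right)+\frac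 MN\right]I(F_0).$$ -/

import Mathlib

open MeasureTheory Matrix
open scoped ENNReal ContDiff

namespace Kac

noncomputable section

/-! ### The special orthogonal group and its Haar measure -/

instance instIsTopologicalGroupSO (n : Type*) [Fintype n] [DecidableEq n] :
    IsTopologicalGroup (specialOrthogonalGroup n ℝ) where
  continuous_inv := by
    refine Continuous.subtype_mk ?_ _
    exact continuous_star.comp continuous_subtype_val

instance instCompactSpaceSO (n : Type*) [Fintype n] [DecidableEq n] :
    CompactSpace (specialOrthogonalGroup n ℝ) := by
  have hclosed : IsClosed {A : Matrix n n ℝ | A * star A = 1 ∧ A.det = 1} :=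
    (isClosed_eq (continuous_id.mul continuous_star) continuous_const).inter
      (isClosed_eq (Continuous.matrix_det continuous_id) continuous_const)
  have hset : (specialOrthogonalGroup n ℝ : Set (Matrix n n ℝ)) =
      {A : Matrix n n ℝ | A * star A = 1 ∧ A.det = 1} := by
    ext A
    exact mem_specialOrthogonalGroup_iff.trans (and_congr_left' mem_unitaryGroup_iff)
  have hcpt : IsCompact (Set.pi Set.univ (fun _ : n => Set.pi Set.univ
      (fun _ : n => Set.Icc (-1 : ℝ) 1))) :=
    isCompact_univ_pi fun _ => isCompact_univ_pi fun _ => isCompact_Icc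
  have : IsCompact (specialOrthogonalGroup n ℝ : Set (Matrix n n ℝ)) := by
    refine hcpt.of_isClosed_subset (hset ▸ hclosed) ?_
    intro A hA i _ j _
    have h := entry_norm_bound_of_unitary (mem_specialOrthogonalGroup_iff.1 hA).1 i j
    exact abs_le.1 h
  exact isCompact_iff_compactSpace.1 this

instance instMeasurableSpaceSO (n : Type*) [Fintype n] [DecidableEq n] :
    MeasurableSpace (specialOrthogonalGroup n ℝ) := borel _

instance instBorelSpaceSO (n : Type*) [Fintype n] [DecidableEq n] :
    BorelSpace (specialOrthogonalGroup n ℝ) := ⟨rfl⟩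

/-- The normalized Haar measure on `SO(n)`. -/
def haarSO (n : Type*) [Fintype n] [DecidableEq n] : Measure (specialOrthogonalGroup n ℝ) :=
  Measure.haarMeasure ⊤

/-! ### The sphere, its uniform probability measure, and rotations -/

/-- The normalized uniform measure on the sphere of radius `r` about the origin of `ℝ^ι`,
as a measure on the ambient space: functions on the sphere are represented by functions on
`ℝ^ι`, whose values off the sphere play no role. -/
def sphereMeasure (ι : Type*) [Fintype ι] (r : ℝ) : Measure (EuclideanSpace ℝ ι) :=
  ((volume : Measure (EuclideanSpace ℝ ι)).toSphere Set.univ)⁻¹ •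
    (volume : Measure (EuclideanSpace ℝ ι)).toSphere.map
      (fun x : Metric.sphere (0 : EuclideanSpace ℝ ι) 1 => r • (x : EuclideanSpace ℝ ι))

theorem measurable_smul_coe {ι : Type*} [Fintype ι] (r : ℝ) :
    Measurable (fun x : Metric.sphere (0 : EuclideanSpace ℝ ι) 1 =>
      r • (x : EuclideanSpace ℝ ι)) := by
  fun_prop

instance instIsFiniteMeasureSphere {ι : Type*} [Fintype ι] (r : ℝ) :
    IsFiniteMeasure (sphereMeasure ι r) := by
  constructor
  rw [sphereMeasure, Measure.smul_apply, Measure.map_apply (measurable_smul_coe r) .univ,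
    Set.preimage_univ, smul_eq_mul]
  exact (ENNReal.inv_mul_le_one _).trans_lt ENNReal.one_lt_top

instance instIsProbabilityMeasureSphere {ι : Type*} [Fintype ι] [Nonempty ι] (r : ℝ) :
    IsProbabilityMeasure (sphereMeasure ι r) := by
  constructor
  rw [sphereMeasure, Measure.smul_apply, Measure.map_apply (measurable_smul_coe r) .univ,
    Set.preimage_univ, smul_eq_mul]
  refine ENNReal.inv_mul_cancel ?_ (measure_ne_top _ _)
  exact fun h => Measure.toSphere_ne_zero _ (Measure.measure_univ_eq_zero.1 h)

/-- The action of an orthogonal matrix on Euclidean space. -/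
def rot {ι : Type*} [Fintype ι] [DecidableEq ι] (g : orthogonalGroup ι ℝ) :
    EuclideanSpace ℝ ι ≃ₗᵢ[ℝ] EuclideanSpace ℝ ι :=
  Unitary.linearIsometryEquiv
    ⟨toEuclideanCLM (𝕜 := ℝ) (n := ι) (g : Matrix ι ι ℝ), Unitary.map_mem _ g.2⟩

theorem rot_apply {ι : Type*} [Fintype ι] [DecidableEq ι] (g : orthogonalGroup ι ℝ)
    (x : EuclideanSpace ℝ ι) (k : ι) : rot g x k = ((g : Matrix ι ι ℝ) *ᵥ x.ofLp) k :=
  rfl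

open scoped Pointwise in
theorem toSphere_preimage_isometry {E : Type*} [NormedAddCommGroup E] [InnerProductSpace ℝ E]
    [FiniteDimensional ℝ E] [MeasurableSpace E] [BorelSpace E] (r : ℝ) (e : E ≃ₗᵢ[ℝ] E)
    {s : Set E} (hs : MeasurableSet s) :
    (volume : Measure E).toSphere ((fun x : Metric.sphere (0 : E) 1 => r • (x : E)) ⁻¹' (e ⁻¹' s))
      = (volume : Measure E).toSphere ((fun x : Metric.sphere (0 : E) 1 => r • (x : E)) ⁻¹' s) := by
  have hf : Measurable (fun x : Metric.sphere (0 : E) 1 => r • (x : E)) := by fun_prop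
  rw [Measure.toSphere_apply' _ (hf hs),
    Measure.toSphere_apply' _ (hf (e.continuous.measurable hs))]
  congr 1
  rw [← e.measurePreserving.measure_preimage_emb e.toHomeomorph.measurableEmbedding
    (Set.Ioo (0 : ℝ) 1 • (Subtype.val '' ((fun x : Metric.sphere (0 : E) 1 => r • (x : E)) ⁻¹' s)))]
  congr 1
  ext x
  simp only [Set.mem_smul, Set.mem_preimage, Set.mem_image, Subtype.exists]
  constructor
  · rintro ⟨c, hc, _, ⟨y, hy, hys, rfl⟩, rfl⟩
    exact ⟨c, hc, e y, ⟨e y, by simpa using hy, by simpa using hys, rfl⟩, by simp⟩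
  · rintro ⟨c, hc, _, ⟨y, hy, hys, rfl⟩, hx⟩
    refine ⟨c, hc, e.symm y, ⟨e.symm y, by simpa using hy, by simpa using hys, rfl⟩, ?_⟩
    rw [← map_smul, hx, e.symm_apply_apply]

theorem measurePreserving_isometry {ι : Type*} [Fintype ι] (r : ℝ)
    (e : EuclideanSpace ℝ ι ≃ₗᵢ[ℝ] EuclideanSpace ℝ ι) :
    MeasurePreserving e (sphereMeasure ι r) (sphereMeasure ι r) := by
  have he : Measurable e := e.continuous.measurable
  refine ⟨he, ?_⟩
  ext s hs
  rw [Measure.map_apply he hs, sphereMeasure, Measure.smul_apply, Measure.smul_apply,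
    Measure.map_apply (measurable_smul_coe r) hs,
    Measure.map_apply (measurable_smul_coe r) (he hs), toSphere_preimage_isometry r e hs]

/-- `L¹` of the sphere of radius `r`, with respect to the normalized uniform measure. -/
abbrev SphereL1 (ι : Type*) [Fintype ι] (r : ℝ) : Type _ := Lp ℝ 1 (sphereMeasure ι r)

/-- The action of orthogonal matrices on functions: `(act g F)(x) = F (g⁻¹ x)`. -/
def act {ι : Type*} [Fintype ι] [DecidableEq ι] {r : ℝ} (g : orthogonalGroup ι ℝ) :
    SphereL1 ι r →ₗᵢ[ℝ] SphereL1 ι r :=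
  Lp.compMeasurePreservingₗᵢ ℝ (rot g⁻¹) (measurePreserving_isometry r (rot g⁻¹))

theorem act_coeFn {ι : Type*} [Fintype ι] [DecidableEq ι] {r : ℝ} (g : orthogonalGroup ι ℝ)
    (F : SphereL1 ι r) :
    ⇑(act g F) =ᵐ[sphereMeasure ι r] fun x => F (rot g⁻¹ x) :=
  Lp.coeFn_compMeasurePreserving F (measurePreserving_isometry r (rot g⁻¹))

theorem continuous_act {ι : Type*} [Fintype ι] [DecidableEq ι] {r : ℝ} (F : SphereL1 ι r) :
    Continuous fun g : orthogonalGroup ι ℝ => act g F := by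
  let c : orthogonalGroup ι ℝ → C(EuclideanSpace ℝ ι, EuclideanSpace ℝ ι) :=
    fun g => ⟨rot g⁻¹, (rot g⁻¹).continuous⟩
  have hc : Continuous c := by
    refine ContinuousMap.continuous_of_continuous_uncurry _ ?_
    change Continuous fun p : orthogonalGroup ι ℝ × EuclideanSpace ℝ ι =>
      WithLp.toLp 2 (((p.1⁻¹ : orthogonalGroup ι ℝ) : Matrix ι ι ℝ) *ᵥ p.2.ofLp)
    refine (PiLp.continuous_toLp 2 _).comp (Continuous.matrix_mulVec ?_ ?_)
    · exact continuous_subtype_val.comp (continuous_inv.comp continuous_fst)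
    · exact (PiLp.continuous_ofLp 2 _).comp continuous_snd
  exact (continuous_const (y := F)).compMeasurePreservingLp hc
    (fun g => measurePreserving_isometry r (rot g⁻¹)) ENNReal.one_ne_top

/-! ### Collisions and the Kac evolution -/

/-- The matrix of the rotation `r_{ij}(θ)` in the plane of the coordinates `i ≠ j`. -/
def planeMatrix {ι : Type*} [DecidableEq ι] (i j : ι) (θ : ℝ) : Matrix ι ι ℝ := fun a =>
  if a = i then Pi.single i (Real.cos θ) + Pi.single j (Real.sin θ)
  else if a = j then Pi.single i (-Real.sin θ) + Pi.single j (Real.cos θ)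
  else Pi.single a 1

theorem planeMatrix_mem {ι : Type*} [Fintype ι] [DecidableEq ι] {i j : ι} (h : i ≠ j) (θ : ℝ) :
    planeMatrix i j θ ∈ orthogonalGroup ι ℝ := by
  rw [mem_orthogonalGroup_iff]
  ext a b
  change planeMatrix i j θ a ⬝ᵥ planeMatrix i j θ b = _
  by_cases hai : a = i <;> by_cases haj : a = j <;> by_cases hbi : b = i <;>
    by_cases hbj : b = j <;>
    simp_all [planeMatrix, Pi.single_apply, Matrix.one_apply] <;> grind [Real.cos_sq_add_sin_sq θ]

/-- The rotation `r_{ij}(θ)`, characterized by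
`(r_{ij}(θ)⁻¹ x)_i = x_i cos θ - x_j sin θ`, `(r_{ij}(θ)⁻¹ x)_j = x_i sin θ + x_j cos θ`, the
other coordinates being unchanged. (For `i = j`, which never occurs, it is the identity.) -/
def planeRotation {ι : Type*} [Fintype ι] [DecidableEq ι] (i j : ι) (θ : ℝ) :
    orthogonalGroup ι ℝ :=
  if h : i ≠ j then ⟨planeMatrix i j θ, planeMatrix_mem h θ⟩ else 1

theorem rot_planeRotation_inv {ι : Type*} [Fintype ι] [DecidableEq ι] {i j : ι} (h : i ≠ j)
    (θ : ℝ) (x : EuclideanSpace ℝ ι) (k : ι) :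
    rot (planeRotation i j θ)⁻¹ x k =
      if k = i then x i * Real.cos θ - x j * Real.sin θ
      else if k = j then x i * Real.sin θ + x j * Real.cos θ
      else x k := by
  have ht : ((planeRotation i j θ)⁻¹ : orthogonalGroup ι ℝ).1 = planeMatrix i j (-θ) := by
    rw [planeRotation, dif_pos h]
    change (planeMatrix i j θ)ᵀ = _
    ext a b
    by_cases hai : a = i <;> by_cases haj : a = j <;> by_cases hbi : b = i <;>
      by_cases hbj : b = j <;>
      simp_all [planeMatrix, Pi.single_apply, eq_comm]
  rw [rot_apply, ht]
  change planeMatrix i j (-θ) k ⬝ᵥ x.ofLp = _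
  by_cases hki : k = i <;> by_cases hkj : k = j <;>
    simp_all [planeMatrix, add_dotProduct] <;> ring

theorem continuous_planeRotation {ι : Type*} [Fintype ι] [DecidableEq ι] (i j : ι) :
    Continuous (planeRotation i j : ℝ → orthogonalGroup ι ℝ) := by
  unfold planeRotation
  by_cases h : i ≠ j
  · simp only [dif_pos h]
    refine Continuous.subtype_mk (continuous_matrix fun a b => ?_) _
    unfold planeMatrix
    split_ifs <;> simp only [Pi.add_apply, Pi.single_apply] <;> split_ifs <;> fun_prop
  · simp only [dif_neg h]
    exact continuous_const

theorem integrable_act_planeRotation {ι : Type*} [Fintype ι] [DecidableEq ι] {r : ℝ}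
    (ν : Measure ℝ) [IsFiniteMeasure ν] (i j : ι) (F : SphereL1 ι r) :
    Integrable (fun θ : ℝ => act (planeRotation i j θ) F) ν := by
  refine Integrable.of_bound
    ((continuous_act F).comp (continuous_planeRotation i j)).aestronglyMeasurable ‖F‖ (.of_forall fun θ => ?_)
  rw [LinearIsometry.norm_map]

/-- The averaged collision operator `R_{ij} F = ∫ F ∘ r_{ij}(θ)⁻¹ ν(dθ)` on `L¹`. -/
def collision {ι : Type*} [Fintype ι] [DecidableEq ι] {r : ℝ} (ν : Measure ℝ)
    [IsProbabilityMeasure ν] (i j : ι) : SphereL1 ι r →L[ℝ] SphereL1 ι r :=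
  LinearMap.mkContinuous
    { toFun := fun F => ∫ θ, act (planeRotation i j θ) F ∂ν
      map_add' := fun F G => by
        simp only [map_add]
        exact integral_add (integrable_act_planeRotation ν i j F)
          (integrable_act_planeRotation ν i j G)
      map_smul' := fun c F => by
        simp only [map_smul, RingHom.id_apply]
        exact integral_smul c _ }
    1 fun F => by
      refine (norm_integral_le_of_norm_le_const (C := ‖F‖) (.of_forall fun θ => ?_)).trans ?_
      · rw [LinearIsometry.norm_map]
      · simp

/-- The labels of the particles: `inl i` for those of the system (with velocities `v`), `inr j`
for those of the reservoir (with velocities `w`). -/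
abbrev Particles (M N : ℕ) : Type := Fin M ⊕ Fin N

/-- States: `L¹` functions on the sphere of radius `√(M+N)` in `ℝ^{M+N}`. -/
abbrev State (M N : ℕ) : Type := SphereL1 (Particles M N) (Real.sqrt (M + N))

/-- The generator of the Kac evolution of a system of `M` particles coupled to a reservoir of
`N` particles, with rates `lamS`, `lamR`, `mu`. For `M = 1` (resp. `N = 1`) the first (resp. second)
sum is empty. -/
def generator (M N : ℕ) (lamS lamR mu : ℝ) (ν : Measure ℝ) [IsProbabilityMeasure ν] :
    State M N →L[ℝ] State M N :=
  (lamS / ((M : ℝ) - 1)) • ∑ i : Fin M, ∑ j ∈ Finset.Ioi i,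
      (collision ν (Sum.inl i) (Sum.inl j) - 1) +
    (lamR / ((N : ℝ) - 1)) • ∑ i : Fin N, ∑ j ∈ Finset.Ioi i,
      (collision ν (Sum.inr i) (Sum.inr j) - 1) +
    (mu / (N : ℝ)) • ∑ i : Fin M, ∑ j : Fin N,
      (collision ν (Sum.inl i) (Sum.inr j) - 1)

/-- The semigroup `e^{𝓛 t}`, for the bounded operator `𝓛` on `L¹`. -/
def evolution (M N : ℕ) (lamS lamR mu : ℝ) (ν : Measure ℝ) [IsProbabilityMeasure ν] (t : ℝ) :
    State M N →L[ℝ] State M N :=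
  NormedSpace.exp (t • generator M N lamS lamR mu ν)

/-! ### Rotations of the reservoir and the marginal -/

/-- The rotation `(v, w) ↦ (v, S w)` for `S ∈ SO(N)`. -/
def reservoirRotation {M N : ℕ} (S : specialOrthogonalGroup (Fin N) ℝ) :
    orthogonalGroup (Particles M N) ℝ :=
  ⟨fromBlocks 1 0 0 (S : Matrix (Fin N) (Fin N) ℝ), by
    have h := (mem_orthogonalGroup_iff _ _).1 (mem_specialOrthogonalGroup_iff.1 S.2).1
    rw [mem_orthogonalGroup_iff, fromBlocks_transpose, fromBlocks_multiply, h]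
    simp⟩

/-- The marginal `𝒩 F (v, w) = ∫_{SO(N)} F (v, S⁻¹ w) dS`. -/
def marginal {M N : ℕ} (F : State M N) : State M N :=
  ∫ S, act (reservoirRotation S) F ∂(haarSO (Fin N))

/-! ### Fisher information -/

/-- The vector field `x_i e_j - x_j e_i` generating the rotations in the `(i, j)` plane. These
fields are divergence-free on every sphere about the origin, and they span its tangent spaces. -/
def rotField {ι : Type*} [Fintype ι] [DecidableEq ι] (i j : ι) (x : EuclideanSpace ℝ ι) :
    EuclideanSpace ℝ ι :=
  x i • EuclideanSpace.single j 1 - x j • EuclideanSpace.single i 1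

/-- `G` is the weak (distributional) gradient of `F` on the sphere of radius `r`: an integrable
tangential vector field such that integration by parts
`∫ F (x_i ∂_j - x_j ∂_i) φ dσ = - ∫ φ (x_i G_j - x_j G_i) dσ` holds for all smooth `φ`. -/
structure IsWeakGradient {ι : Type*} [Fintype ι] [DecidableEq ι] (r : ℝ)
    (F : EuclideanSpace ℝ ι → ℝ) (G : EuclideanSpace ℝ ι → EuclideanSpace ℝ ι) : Prop where
  integrable : Integrable G (sphereMeasure ι r)
  tangent : ∀ᵐ x ∂(sphereMeasure ι r), inner ℝ x (G x) = 0
  integral_eq : ∀ (i j : ι) (φ : EuclideanSpace ℝ ι → ℝ), ContDiff ℝ ∞ φ →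
    ∫ x, F x * fderiv ℝ φ x (rotField i j x) ∂(sphereMeasure ι r) =
      -∫ x, φ x * inner ℝ (rotField i j x) (G x) ∂(sphereMeasure ι r)

/-- The Fisher information `I(F) = ∫ |∇F|² / F dσ` of a nonnegative `F` on the sphere of radius
`r`, with values in `[0, ∞]`. The weak gradient is unique up to null sets, so the infimum only
picks the value given by it, or `∞` if there is none. (In `[0, ∞]`, `0 / 0 = 0`, and
the weak gradient vanishes a.e. where `F` does.) -/
def fisherInformation {ι : Type*} [Fintype ι] [DecidableEq ι] (r : ℝ)
    (F : EuclideanSpace ℝ ι → ℝ) : ℝ≥0∞ :=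
  ⨅ (G : EuclideanSpace ℝ ι → EuclideanSpace ℝ ι) (_ : IsWeakGradient r F G),
    ∫⁻ x, ‖G x‖ₑ ^ 2 / ENNReal.ofReal (F x) ∂(sphereMeasure ι r)

/-- The Fisher information of a state on the sphere of radius `√(M+N)`. -/
def information {M N : ℕ} (F : State M N) : ℝ≥0∞ :=
  fisherInformation (Real.sqrt (M + N)) F

end

end Kac

namespace Kac

noncomputable section

/-! ### Rotations acting on the sphere -/

section Sphere

variable {ι : Type*} [Fintype ι]

/-! A function and its gradient move together. A rotation `g` acts on the pair `y = (F, ∇F)`, and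
averages over random rotations preserve the closed space `weakGradients` of such pairs; hence the
generator, its exponential and the marginal all act on pairs. Let `z` be the final pair. The
information is the supremum over bounded fields `h` of `∫ (2 h·∇F - |h|² F)`. Testing `z` with
truncations `h` of `z.2 / z.1` gives a continuous linear functional `l`
(`lintegral_le_of_truncatedQuotient`), which can be pulled back through all the averages, so that
only its values on rotated copies `push g y` of the initial pair have to be bounded.

The gain comes from symmetry. Since `z` is invariant under rotations of the reservoir, the reservoir
part of `h` is parallel to `w` (`parallel_of_invariant`). Such an `h` sees of a tangent vector only
its system part and its component along `w`, and tangency expresses the latter through the system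
part (`inner_sq_mul_norm_sq_le`). Integrated, this bounds `l (push g y)` by the sum over system
indices `i` of `b(g⁻¹eᵢ, g⁻¹eᵢ)`, with `b(u, u) = ∫ ((u·∇F)² + (u·x)²|∇F|²/r²)/F`
(`functional_push_le`). The trace of `b` is `2 I(F)` (`fisherForm_trace`).

What remains is a computation with the rows of `g`. A collision mixes two rows, and `∫ sin θ cos θ
dν = 0` removes the off-diagonal terms. So a bound by `α` times the system sum plus `β` times the
reservoir sum keeps its form; collisions inside the system or inside the reservoir leave it
unchanged. With `s = ∫ sin² θ dν`, the coefficients solve `α' = μ s (β - α)`, `β' = μ s (M/N)(α -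
β)` from `(1, 0)` (`apply_exp_generatorPair_le`). Thus `β ≤ α = M/(M+N) + e N/(M+N)`, where `e` is
the exponential factor, and as `b` is nonnegative on the diagonal the bound is at most `α` times the
trace, `2 α I(F)`. The summand `M/N` of the theorem is slack. -/

theorem ae_norm_eq {r : ℝ} (hr : 0 ≤ r) : ∀ᵐ x ∂(sphereMeasure ι r), ‖x‖ = r := by
  have hs : MeasurableSet {x : EuclideanSpace ℝ ι | ‖x‖ = r} :=
    (isClosed_eq continuous_norm continuous_const).measurableSet
  refine Measure.ae_smul_measure ?_ _
  rw [ae_map_iff (measurable_smul_coe r).aemeasurable hs]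
  refine .of_forall fun x => ?_
  rw [norm_smul, Real.norm_of_nonneg hr, mem_sphere_zero_iff_norm.1 x.2, mul_one]

variable [DecidableEq ι]

theorem rot_mul_apply (g h : orthogonalGroup ι ℝ) (x : EuclideanSpace ℝ ι) :
    rot (g * h) x = rot g (rot h x) := by
  ext k
  rw [rot_apply, rot_apply]
  have : (rot h x).ofLp = (h : Matrix ι ι ℝ) *ᵥ x.ofLp := by
    ext k
    rw [rot_apply]
  rw [this, mulVec_mulVec]
  rfl

theorem rot_one_apply (x : EuclideanSpace ℝ ι) : rot (1 : orthogonalGroup ι ℝ) x = x := by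
  ext k
  rw [rot_apply]
  simp

@[simp]
theorem rot_inv_rot (g : orthogonalGroup ι ℝ) (x : EuclideanSpace ℝ ι) :
    rot g⁻¹ (rot g x) = x := by
  rw [← rot_mul_apply, inv_mul_cancel, rot_one_apply]

@[simp]
theorem rot_rot_inv (g : orthogonalGroup ι ℝ) (x : EuclideanSpace ℝ ι) :
    rot g (rot g⁻¹ x) = x := by
  rw [← rot_mul_apply, mul_inv_cancel, rot_one_apply]

theorem inner_rot_left (g : orthogonalGroup ι ℝ) (x y : EuclideanSpace ℝ ι) :
    inner ℝ (rot g x) y = inner ℝ x (rot g⁻¹ y) := by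
  rw [← LinearIsometryEquiv.inner_map_map (rot g) x (rot g⁻¹ y), rot_rot_inv]

/-- The change of variables `x ↦ g⁻¹ x` in integrals over the sphere. -/
theorem integral_comp_rot {E : Type*} [NormedAddCommGroup E] [NormedSpace ℝ E] (r : ℝ)
    (g : orthogonalGroup ι ℝ) (f : EuclideanSpace ℝ ι → E) :
    ∫ x, f (rot g x) ∂(sphereMeasure ι r) = ∫ x, f x ∂(sphereMeasure ι r) :=
  (measurePreserving_isometry r (rot g)).integral_comp
    (rot g).toHomeomorph.measurableEmbedding f

theorem ae_rot {r : ℝ} (g : orthogonalGroup ι ℝ) {p : EuclideanSpace ℝ ι → Prop}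
    (h : ∀ᵐ x ∂(sphereMeasure ι r), p x) : ∀ᵐ x ∂(sphereMeasure ι r), p (rot g x) :=
  (measurePreserving_isometry r (rot g)).quasiMeasurePreserving.ae h

theorem continuous_rot_apply (x : EuclideanSpace ℝ ι) :
    Continuous fun g : orthogonalGroup ι ℝ => rot g x := by
  change Continuous fun g : orthogonalGroup ι ℝ =>
      WithLp.toLp 2 ((g : Matrix ι ι ℝ) *ᵥ x.ofLp)
  exact (PiLp.continuous_toLp 2 _).comp
    (Continuous.matrix_mulVec continuous_subtype_val continuous_const)

theorem continuous_rot :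
    Continuous fun g : orthogonalGroup ι ℝ =>
      ((rot g).toContinuousLinearEquiv : EuclideanSpace ℝ ι →L[ℝ] EuclideanSpace ℝ ι) :=
  continuous_clm_apply.2 fun x => continuous_rot_apply x

end Sphere

/-! ### Vector fields and pairs of a function and a vector field -/

section Pairs

variable {ι : Type*} [Fintype ι] [DecidableEq ι] {r : ℝ}

variable (ι r) in
/-- Integrable vector fields on the sphere. -/
abbrev FieldL1 : Type _ := Lp (EuclideanSpace ℝ ι) 1 (sphereMeasure ι r)

/-- The action of orthogonal matrices on vector fields: `(actField g G)(x) = g G(g⁻¹ x)`. -/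
def actField (g : orthogonalGroup ι ℝ) : FieldL1 ι r →L[ℝ] FieldL1 ι r :=
  (ContinuousLinearMap.compLpL 1 (sphereMeasure ι r)
      ((rot g).toContinuousLinearEquiv : EuclideanSpace ℝ ι →L[ℝ] EuclideanSpace ℝ ι)).comp
    (Lp.compMeasurePreservingₗᵢ ℝ (rot g⁻¹)
      (measurePreserving_isometry r (rot g⁻¹))).toContinuousLinearMap

theorem actField_coeFn (g : orthogonalGroup ι ℝ) (G : FieldL1 ι r) :
    ⇑(actField g G) =ᵐ[sphereMeasure ι r] fun x => rot g (G (rot g⁻¹ x)) := by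
  have h := measurePreserving_isometry r (rot g⁻¹)
  filter_upwards [Lp.coeFn_compMeasurePreserving G h,
    ContinuousLinearMap.coeFn_compLpL (p := 1) (μ := sphereMeasure ι r)
      ((rot g).toContinuousLinearEquiv : EuclideanSpace ℝ ι →L[ℝ] EuclideanSpace ℝ ι)
      (Lp.compMeasurePreserving (rot g⁻¹) h G)] with x h1 h2
  refine h2.trans ?_
  rw [h1]
  rfl

theorem norm_actField_le (g : orthogonalGroup ι ℝ) (G : FieldL1 ι r) :
    ‖actField g G‖ ≤ ‖G‖ := by
  refine (ContinuousLinearMap.norm_compLp_le _ _).trans ?_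
  refine (mul_le_mul (?_ : _ ≤ (1 : ℝ)) (LinearIsometry.norm_map _ G).le (norm_nonneg _)
    zero_le_one).trans (one_mul _).le
  exact (rot g).toLinearIsometry.norm_toContinuousLinearMap_le

theorem continuous_actField (G : FieldL1 ι r) :
    Continuous fun g : orthogonalGroup ι ℝ => actField g G := by
  let c : orthogonalGroup ι ℝ → C(EuclideanSpace ℝ ι, EuclideanSpace ℝ ι) :=
    fun g => ⟨rot g⁻¹, (rot g⁻¹).continuous⟩
  have hc : Continuous c := by
    refine ContinuousMap.continuous_of_continuous_uncurry _ ?_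
    change Continuous fun p : orthogonalGroup ι ℝ × EuclideanSpace ℝ ι =>
      WithLp.toLp 2 (((p.1⁻¹ : orthogonalGroup ι ℝ) : Matrix ι ι ℝ) *ᵥ p.2.ofLp)
    refine (PiLp.continuous_toLp 2 _).comp (Continuous.matrix_mulVec ?_ ?_)
    · exact continuous_subtype_val.comp (continuous_inv.comp continuous_fst)
    · exact (PiLp.continuous_ofLp 2 _).comp continuous_snd
  have hH : Continuous fun g : orthogonalGroup ι ℝ =>
      Lp.compMeasurePreserving (rot g⁻¹) (measurePreserving_isometry r (rot g⁻¹)) G :=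
    (continuous_const (y := G)).compMeasurePreservingLp hc
      (fun g => measurePreserving_isometry r (rot g⁻¹)) ENNReal.one_ne_top
  -- Composition with `L` is linear in `L` and of norm at most `‖L‖`, so norm continuity of `g ↦ rot
  -- g` carries over to operators on fields.
  let T : (EuclideanSpace ℝ ι →L[ℝ] EuclideanSpace ℝ ι) →L[ℝ] FieldL1 ι r →L[ℝ] FieldL1 ι r :=
    LinearMap.mkContinuous
      { toFun := fun L => ContinuousLinearMap.compLpL 1 (sphereMeasure ι r) L
        map_add' := fun L L' => ContinuousLinearMap.add_compLpL L L'
        map_smul' := fun c L => ContinuousLinearMap.smul_compLpL c L } 1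
      fun L => by
        rw [one_mul]
        exact ContinuousLinearMap.opNorm_le_bound _ (norm_nonneg _) L.norm_compLp_le
  exact (T.continuous.comp continuous_rot).clm_apply hH

variable (ι r) in
/-- Pairs of an integrable function and an integrable vector field. -/
abbrev PairL1 : Type _ := SphereL1 ι r × FieldL1 ι r

/-- The simultaneous action of orthogonal matrices on functions and vector fields. -/
def push (g : orthogonalGroup ι ℝ) : PairL1 ι r →L[ℝ] PairL1 ι r :=
  (act g).toContinuousLinearMap.prodMap (actField g)

theorem push_fst (g : orthogonalGroup ι ℝ) (y : PairL1 ι r) : (push g y).1 = act g y.1 := rfl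

theorem push_snd (g : orthogonalGroup ι ℝ) (y : PairL1 ι r) : (push g y).2 = actField g y.2 :=
  rfl

theorem norm_push_le (g : orthogonalGroup ι ℝ) (y : PairL1 ι r) : ‖push g y‖ ≤ ‖y‖ :=
  max_le_max (LinearIsometry.norm_map (act g) y.1).le (norm_actField_le g y.2)

theorem continuous_push (y : PairL1 ι r) :
    Continuous fun g : orthogonalGroup ι ℝ => push g y :=
  (continuous_act y.1).prodMk (continuous_actField y.2)

theorem act_mul (g h : orthogonalGroup ι ℝ) (F : SphereL1 ι r) :
    act (g * h) F = act g (act h F) := by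
  refine Lp.ext ?_
  filter_upwards [act_coeFn (g * h) F, act_coeFn g (act h F), ae_rot g⁻¹ (act_coeFn h F)]
    with x h1 h2 h3
  rw [h1, h2, h3, _root_.mul_inv_rev, rot_mul_apply]

theorem push_mul (g h : orthogonalGroup ι ℝ) (y : PairL1 ι r) :
    push (g * h) y = push g (push h y) := by
  refine Prod.ext (act_mul g h y.1) (Lp.ext ?_)
  filter_upwards [actField_coeFn (g * h) y.2, actField_coeFn g (actField h y.2),
    ae_rot g⁻¹ (actField_coeFn h y.2)] with x h1 h2 h3
  rw [push_snd, push_snd, push_snd, h1, h2, h3, _root_.mul_inv_rev, rot_mul_apply, rot_mul_apply]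

theorem push_one (y : PairL1 ι r) : push 1 y = y := by
  refine Prod.ext (Lp.ext ?_) (Lp.ext ?_)
  · filter_upwards [act_coeFn 1 y.1] with x h
    rw [push_fst, h, inv_one, rot_one_apply]
  · filter_upwards [actField_coeFn 1 y.2] with x h
    rw [push_snd, h, inv_one, rot_one_apply, rot_one_apply]

/-! ### Averages over random rotations -/

section Average

variable {Ω : Type*} [TopologicalSpace Ω] [MeasurableSpace Ω] [OpensMeasurableSpace Ω]

theorem integrable_push (m : Measure Ω) [IsFiniteMeasure m] {γ : Ω → orthogonalGroup ι ℝ}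
    (hγ : Continuous γ) (y : PairL1 ι r) : Integrable (fun s => push (γ s) y) m := by
  have hc : Continuous fun s => push (γ s) y := (continuous_push y).comp hγ
  -- Nothing is assumed about the separability of `Ω`; the separable range needed for strong
  -- measurability comes from the orthogonal group.
  have : SecondCountableTopology (Matrix ι ι ℝ) :=
    inferInstanceAs (SecondCountableTopology (ι → ι → ℝ))
  have : SecondCountableTopology (orthogonalGroup ι ℝ) :=
    TopologicalSpace.Subtype.secondCountableTopology (orthogonalGroup ι ℝ : Set (Matrix ι ι ℝ))
  have hsep : TopologicalSpace.IsSeparable (Set.range fun s => push (γ s) y) := by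
    refine ((TopologicalSpace.IsSeparable.of_separableSpace
      (Set.univ : Set (orthogonalGroup ι ℝ))).image (continuous_push y)).mono ?_
    rintro _ ⟨s, rfl⟩
    exact ⟨γ s, trivial, rfl⟩
  refine Integrable.of_bound (C := ‖y‖) ?_ (.of_forall fun s => norm_push_le _ _)
  borelize (PairL1 ι r)
  exact (stronglyMeasurable_iff_measurable_separable.2
    ⟨hc.measurable, hsep⟩).aestronglyMeasurable

/-- The average of the operators `push (γ s)` over a probability space. -/
def average (m : Measure Ω) [IsProbabilityMeasure m] (γ : C(Ω, orthogonalGroup ι ℝ)) :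
    PairL1 ι r →L[ℝ] PairL1 ι r :=
  LinearMap.mkContinuous
    { toFun := fun y => ∫ s, push (γ s) y ∂m
      map_add' := fun y z => by
        simp only [map_add]
        exact integral_add (integrable_push m γ.continuous y) (integrable_push m γ.continuous z)
      map_smul' := fun c y => by
        simp only [map_smul, RingHom.id_apply]
        exact integral_smul c _ }
    1 fun y => by
      refine (norm_integral_le_of_norm_le_const (C := ‖y‖)
        (.of_forall fun s => norm_push_le _ _)).trans ?_
      simp

theorem average_apply (m : Measure Ω) [IsProbabilityMeasure m] (γ : C(Ω, orthogonalGroup ι ℝ))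
    (y : PairL1 ι r) : average m γ y = ∫ s, push (γ s) y ∂m := rfl

theorem average_fst (m : Measure Ω) [IsProbabilityMeasure m] (γ : C(Ω, orthogonalGroup ι ℝ))
    (y : PairL1 ι r) : (average m γ y).1 = ∫ s, act (γ s) y.1 ∂m :=
  ((ContinuousLinearMap.fst ℝ (SphereL1 ι r) (FieldL1 ι r)).integral_comp_comm
    (integrable_push m γ.continuous y)).symm

/-- A continuous linear functional of an average is the average of the functional. -/
theorem apply_average (m : Measure Ω) [IsProbabilityMeasure m] (γ : C(Ω, orthogonalGroup ι ℝ))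
    (l : PairL1 ι r →L[ℝ] ℝ) (y : PairL1 ι r) :
    l (average m γ y) = ∫ s, l (push (γ s) y) ∂m :=
  (l.integral_comp_comm (integrable_push m γ.continuous y)).symm

/-- A closed subspace is a closed convex set, hence contains the means of probability measures on
it. -/
theorem average_mem (m : Measure Ω) [IsProbabilityMeasure m] (γ : C(Ω, orthogonalGroup ι ℝ))
    {W : Submodule ℝ (PairL1 ι r)} (hW : IsClosed (W : Set (PairL1 ι r)))
    (hpush : ∀ g, ∀ y ∈ W, push g y ∈ W) {y : PairL1 ι r} (hy : y ∈ W) : average m γ y ∈ W :=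
  W.convex.integral_mem hW (.of_forall fun s => hpush (γ s) y hy)
    (integrable_push m γ.continuous y)

end Average

end Pairs

/-! ### Linear functionals on pairs, and the space of functions with their weak gradients -/

section WeakGradient

variable {ι : Type*} [Fintype ι] {r : ℝ}

/-- Continuous functions are bounded on the sphere. -/
theorem exists_bound_of_continuous {E : Type*} [NormedAddCommGroup E] (hr : 0 ≤ r)
    {f : EuclideanSpace ℝ ι → E} (hf : Continuous f) :
    ∃ C, ∀ᵐ x ∂(sphereMeasure ι r), ‖f x‖ ≤ C := by
  obtain ⟨C, hC⟩ := (isCompact_closedBall (0 : EuclideanSpace ℝ ι) r).exists_bound_of_continuousOn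
    hf.continuousOn
  refine ⟨C, (ae_norm_eq hr).mono fun x hx => hC x ?_⟩
  rw [mem_closedBall_zero_iff, hx]

theorem integrable_inner_field {h G : EuclideanSpace ℝ ι → EuclideanSpace ℝ ι} {C : ℝ}
    (hh : AEStronglyMeasurable h (sphereMeasure ι r))
    (hC : ∀ᵐ x ∂(sphereMeasure ι r), ‖h x‖ ≤ C) (hG : Integrable G (sphereMeasure ι r)) :
    Integrable (fun x => inner ℝ (h x) (G x)) (sphereMeasure ι r) :=
  (innerSL ℝ).integrable_of_bilin_of_bdd_left C hh hC hG

theorem integrable_mul_fun {k F : EuclideanSpace ℝ ι → ℝ} {C : ℝ}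
    (hk : AEStronglyMeasurable k (sphereMeasure ι r))
    (hC : ∀ᵐ x ∂(sphereMeasure ι r), ‖k x‖ ≤ C) (hF : Integrable F (sphereMeasure ι r)) :
    Integrable (fun x => k x * F x) (sphereMeasure ι r) :=
  (ContinuousLinearMap.mul ℝ ℝ).integrable_of_bilin_of_bdd_left C hk hC hF

/-- Integration against a bounded vector field and a bounded function. -/
theorem exists_functional {h : EuclideanSpace ℝ ι → EuclideanSpace ℝ ι}
    {k : EuclideanSpace ℝ ι → ℝ} {C D : ℝ}
    (hh : AEStronglyMeasurable h (sphereMeasure ι r))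
    (hC : ∀ᵐ x ∂(sphereMeasure ι r), ‖h x‖ ≤ C)
    (hk : AEStronglyMeasurable k (sphereMeasure ι r))
    (hD : ∀ᵐ x ∂(sphereMeasure ι r), ‖k x‖ ≤ D) :
    ∃ l : PairL1 ι r →L[ℝ] ℝ, ∀ y : PairL1 ι r,
      l y = ∫ x, inner ℝ (h x) (y.2 x) ∂(sphereMeasure ι r) +
        ∫ x, k x * y.1 x ∂(sphereMeasure ι r) := by
  have h1 := memLp_top_of_bound hh C hC
  have k1 := memLp_top_of_bound hk D hD
  refine ⟨((innerSL ℝ).lpPairing (sphereMeasure ι r) ∞ 1 (h1.toLp h)).comp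
      (ContinuousLinearMap.snd ℝ _ _) +
    ((ContinuousLinearMap.mul ℝ ℝ).lpPairing (sphereMeasure ι r) ∞ 1 (k1.toLp k)).comp
      (ContinuousLinearMap.fst ℝ _ _), fun y => ?_⟩
  simp only [_root_.add_apply, ContinuousLinearMap.comp_apply,
    ContinuousLinearMap.coe_fst', ContinuousLinearMap.coe_snd',
    ContinuousLinearMap.lpPairing_eq_integral]
  congr 1
  · refine integral_congr_ae ?_
    filter_upwards [h1.coeFn_toLp] with x hx
    rw [hx]
    rfl
  · refine integral_congr_ae ?_
    filter_upwards [k1.coeFn_toLp] with x hx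
    rw [hx]
    rfl

variable [DecidableEq ι]

theorem continuous_rotField (i j : ι) :
    Continuous (rotField i j : EuclideanSpace ℝ ι → EuclideanSpace ℝ ι) := by
  unfold rotField
  fun_prop

theorem continuous_fderiv_rotField {φ : EuclideanSpace ℝ ι → ℝ} (hφ : ContDiff ℝ ∞ φ) (i j : ι) :
    Continuous fun x => fderiv ℝ φ x (rotField i j x) :=
  (hφ.continuous_fderiv (by simp)).clm_apply (continuous_rotField i j)

theorem continuous_smul_rotField {φ : EuclideanSpace ℝ ι → ℝ} (hφ : ContDiff ℝ ∞ φ) (i j : ι) :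
    Continuous fun x => φ x • rotField i j x :=
  hφ.continuous.smul (continuous_rotField i j)

/-- Being a function with its weak gradient is expressed by continuous linear equations. -/
theorem exists_isWeakGradient_iff (hr : 0 ≤ r) :
    ∃ S : Set (PairL1 ι r →L[ℝ] ℝ), ∀ y : PairL1 ι r,
      IsWeakGradient r y.1 y.2 ↔ ∀ l ∈ S, l y = 0 := by
  have hT (s : Set (EuclideanSpace ℝ ι)) (hs : MeasurableSet s) :
      ∃ l : PairL1 ι r →L[ℝ] ℝ, ∀ y : PairL1 ι r,
        l y = ∫ x in s, inner ℝ x (y.2 x) ∂(sphereMeasure ι r) := by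
    obtain ⟨l, hl⟩ := exists_functional (r := r) (h := s.indicator id) (k := 0) (C := r) (D := 0)
      (measurable_id.indicator hs).aestronglyMeasurable
      ((ae_norm_eq hr).mono fun x hx => (norm_indicator_le_norm_self _ _).trans hx.le)
      aestronglyMeasurable_zero (by simp)
    refine ⟨l, fun y => ?_⟩
    rw [hl, ← integral_indicator hs]
    simp only [Pi.zero_apply, zero_mul, integral_zero, add_zero]
    refine integral_congr_ae (.of_forall fun x => ?_)
    by_cases hx : x ∈ s <;> simp [hx]
  have hI (i j : ι) (φ : EuclideanSpace ℝ ι → ℝ) (hφ : ContDiff ℝ ∞ φ) :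
      ∃ l : PairL1 ι r →L[ℝ] ℝ, ∀ y : PairL1 ι r,
        l y = ∫ x, φ x * inner ℝ (rotField i j x) (y.2 x) ∂(sphereMeasure ι r) +
          ∫ x, y.1 x * fderiv ℝ φ x (rotField i j x) ∂(sphereMeasure ι r) := by
    obtain ⟨C, hC⟩ := exists_bound_of_continuous hr (continuous_smul_rotField hφ i j)
    obtain ⟨D, hD⟩ := exists_bound_of_continuous hr (continuous_fderiv_rotField hφ i j)
    obtain ⟨l, hl⟩ := exists_functional (r := r)
      (continuous_smul_rotField hφ i j).aestronglyMeasurable hC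
      (continuous_fderiv_rotField hφ i j).aestronglyMeasurable hD
    refine ⟨l, fun y => ?_⟩
    rw [hl]
    simp only [real_inner_smul_left, mul_comm]
  choose! T hT using hT
  choose! J hJ using hI
  refine ⟨{l | (∃ s, MeasurableSet s ∧ l = T s) ∨
    ∃ i j φ, ContDiff ℝ ∞ φ ∧ l = J i j φ}, fun y => ⟨fun h l hl => ?_, fun h => ?_⟩⟩
  · rcases hl with ⟨s, hs, rfl⟩ | ⟨i, j, φ, hφ, rfl⟩
    · rw [hT s hs, setIntegral_congr_ae (g := fun _ => (0 : ℝ)) hs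
        (h.tangent.mono fun x hx _ => hx),
        integral_zero]
    · rw [hJ i j φ hφ, h.integral_eq i j φ hφ, add_neg_cancel]
  · refine ⟨L1.integrable_coeFn y.2, ?_, fun i j φ hφ => ?_⟩
    -- Tangency is pointwise, but it is equivalent to the vanishing of the integrals of `x·G` over
    -- all measurable sets, which are the functionals `T s`.
    · refine Integrable.ae_eq_zero_of_forall_setIntegral_eq_zero
        (integrable_inner_field (h := id) aestronglyMeasurable_id
          ((ae_norm_eq hr).mono fun x hx => hx.le) (L1.integrable_coeFn y.2))
        fun s hs _ => ?_
      exact (hT s hs y).symm.trans (h _ (.inl ⟨s, hs, rfl⟩))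
    · have := h _ (.inr ⟨i, j, φ, hφ, rfl⟩)
      rw [hJ i j φ hφ] at this
      linarith

/-- The space of pairs that consist of a function and its weak gradient. -/
def weakGradients (hr : 0 ≤ r) : Submodule ℝ (PairL1 ι r) where
  carrier := {y | IsWeakGradient r y.1 y.2}
  add_mem' := by
    obtain ⟨S, hS⟩ := exists_isWeakGradient_iff (ι := ι) hr
    intro y z hy hz
    refine (hS _).2 fun l hl => ?_
    rw [map_add, (hS y).1 hy l hl, (hS z).1 hz l hl, add_zero]
  zero_mem' := by
    obtain ⟨S, hS⟩ := exists_isWeakGradient_iff (ι := ι) hr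
    exact (hS 0).2 fun l _ => map_zero l
  smul_mem' := by
    obtain ⟨S, hS⟩ := exists_isWeakGradient_iff (ι := ι) hr
    intro c y hy
    refine (hS _).2 fun l hl => ?_
    rw [map_smul, (hS y).1 hy l hl, smul_zero]

theorem mem_weakGradients {hr : 0 ≤ r} {y : PairL1 ι r} :
    y ∈ weakGradients hr ↔ IsWeakGradient r y.1 y.2 := Iff.rfl

theorem isClosed_weakGradients (hr : 0 ≤ r) :
    IsClosed ((weakGradients hr : Submodule ℝ (PairL1 ι r)) : Set (PairL1 ι r)) := by
  obtain ⟨S, hS⟩ := exists_isWeakGradient_iff (ι := ι) hr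
  have : ((weakGradients hr : Submodule ℝ (PairL1 ι r)) : Set (PairL1 ι r)) =
      ⋂ l ∈ S, {y | l y = 0} := by
    ext y
    simp only [Set.mem_iInter, Set.mem_ofPred_eq]
    exact hS y
  rw [this]
  exact isClosed_biInter fun l _ => isClosed_eq l.continuous continuous_const

/-! ### Equivariance of weak gradients under rotations -/

/-- The infinitesimal rotation in the plane spanned by two vectors. -/
def wedgeField (u v x : EuclideanSpace ℝ ι) : EuclideanSpace ℝ ι :=
  inner ℝ u x • v - inner ℝ v x • u

theorem wedgeField_eq_sum (u v x : EuclideanSpace ℝ ι) :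
    wedgeField u v x = ∑ i, ∑ j, (u i * v j) • rotField i j x := by
  ext k
  simp only [wedgeField, rotField, PiLp.sub_apply, PiLp.smul_apply, smul_eq_mul,
    PiLp.inner_apply, RCLike.inner_apply, conj_trivial, WithLp.ofLp_sum, Finset.sum_apply,
    PiLp.single_apply, mul_sub, Finset.sum_sub_distrib, mul_ite, mul_one, mul_zero,
    Finset.sum_ite_eq, Finset.mem_univ, if_true, Finset.sum_mul]
  congr 1
  · exact Finset.sum_congr rfl fun i _ => by ring
  · rw [Finset.sum_comm]
    simp only [Finset.sum_ite_eq, Finset.mem_univ, if_true]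
    exact Finset.sum_congr rfl fun i _ => by ring

theorem rotField_rot (g : orthogonalGroup ι ℝ) (i j : ι) (x : EuclideanSpace ℝ ι) :
    rotField i j (rot g x) = rot g (wedgeField (rot g⁻¹ (EuclideanSpace.single i 1))
      (rot g⁻¹ (EuclideanSpace.single j 1)) x) := by
  have h (k : ι) : inner ℝ (rot g⁻¹ (EuclideanSpace.single k 1)) x = rot g x k := by
    rw [inner_rot_left, inv_inv, EuclideanSpace.inner_single_left]
    simp
  rw [wedgeField, h, h, map_sub, map_smul, map_smul, rot_rot_inv, rot_rot_inv, rotField]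

theorem integral_wedgeField (hr : 0 ≤ r) {F : EuclideanSpace ℝ ι → ℝ}
    {G : EuclideanSpace ℝ ι → EuclideanSpace ℝ ι} (hF : Integrable F (sphereMeasure ι r))
    (h : IsWeakGradient r F G) (u v : EuclideanSpace ℝ ι) {φ : EuclideanSpace ℝ ι → ℝ}
    (hφ : ContDiff ℝ ∞ φ) :
    ∫ x, F x * fderiv ℝ φ x (wedgeField u v x) ∂(sphereMeasure ι r) =
      -∫ x, φ x * inner ℝ (wedgeField u v x) (G x) ∂(sphereMeasure ι r) := by
  have h1 (i j : ι) : Integrable (fun x => F x * fderiv ℝ φ x (rotField i j x))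
      (sphereMeasure ι r) := by
    obtain ⟨D, hD⟩ := exists_bound_of_continuous hr (continuous_fderiv_rotField hφ i j)
    simpa only [mul_comm] using integrable_mul_fun
      (continuous_fderiv_rotField hφ i j).aestronglyMeasurable hD hF
  have h2 (i j : ι) : Integrable (fun x => φ x * inner ℝ (rotField i j x) (G x))
      (sphereMeasure ι r) := by
    obtain ⟨D, hD⟩ := exists_bound_of_continuous hr (continuous_smul_rotField hφ i j)
    simpa only [real_inner_smul_left] using integrable_inner_field
      (continuous_smul_rotField hφ i j).aestronglyMeasurable hD h.integrable
  have e1 (x : EuclideanSpace ℝ ι) : F x * fderiv ℝ φ x (wedgeField u v x) =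
      ∑ i, ∑ j, (u i * v j) * (F x * fderiv ℝ φ x (rotField i j x)) := by
    simp only [wedgeField_eq_sum, map_sum, map_smul, smul_eq_mul, Finset.mul_sum]
    exact Finset.sum_congr rfl fun i _ => Finset.sum_congr rfl fun j _ => by ring
  have e2 (x : EuclideanSpace ℝ ι) : φ x * inner ℝ (wedgeField u v x) (G x) =
      ∑ i, ∑ j, (u i * v j) * (φ x * inner ℝ (rotField i j x) (G x)) := by
    simp only [wedgeField_eq_sum, sum_inner, real_inner_smul_left, Finset.mul_sum]
    exact Finset.sum_congr rfl fun i _ => Finset.sum_congr rfl fun j _ => by ring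
  simp only [e1, e2]
  rw [integral_finsetSum _ fun i _ => integrable_finsetSum _ fun j _ => (h1 i j).const_mul _,
    integral_finsetSum _ fun i _ => integrable_finsetSum _ fun j _ => (h2 i j).const_mul _,
    ← Finset.sum_neg_distrib]
  refine Finset.sum_congr rfl fun i _ => ?_
  rw [integral_finsetSum _ fun j _ => (h1 i j).const_mul _,
    integral_finsetSum _ fun j _ => (h2 i j).const_mul _, ← Finset.sum_neg_distrib]
  refine Finset.sum_congr rfl fun j _ => ?_
  rw [integral_const_mul, integral_const_mul, h.integral_eq i j φ hφ, mul_neg]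

/-- Moving `g` onto the test function turns the rotation field of a coordinate plane into that of
the plane of `g⁻¹eᵢ` and `g⁻¹eⱼ`. This is a combination of coordinate fields, so
`integral_wedgeField` applies. -/
theorem push_mem_weakGradients (hr : 0 ≤ r) (g : orthogonalGroup ι ℝ) {y : PairL1 ι r}
    (hy : y ∈ weakGradients hr) : push g y ∈ weakGradients hr := by
  have hw := mem_weakGradients.1 hy
  refine ⟨L1.integrable_coeFn _, ?_, fun i j φ hφ => ?_⟩
  · filter_upwards [actField_coeFn g y.2, ae_rot g⁻¹ hw.tangent] with x h1 h2
    rw [push_snd, h1, ← inv_inv g, ← inner_rot_left, inv_inv]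
    exact h2
  · have hφg : ContDiff ℝ ∞ (φ ∘ rot g) := hφ.comp (rot g).contDiff
    have hd (x z : EuclideanSpace ℝ ι) :
        fderiv ℝ (φ ∘ rot g) x z = fderiv ℝ φ (rot g x) (rot g z) := by
      rw [fderiv_comp x (hφ.differentiable (by simp) _) (rot g).differentiableAt,
        LinearIsometryEquiv.fderiv]
      rfl
    have key := integral_wedgeField hr (L1.integrable_coeFn y.1) hw
      (rot g⁻¹ (EuclideanSpace.single i 1)) (rot g⁻¹ (EuclideanSpace.single j 1)) hφg
    rw [← integral_comp_rot r g, ← integral_comp_rot r g (fun x => φ x * _)]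
    refine Eq.trans (integral_congr_ae ?_) (key.trans (congrArg _ (integral_congr_ae ?_)))
    · filter_upwards [ae_rot g (act_coeFn g y.1)] with x hx
      rw [push_fst, hx, rot_inv_rot, hd, rotField_rot]
    · filter_upwards [ae_rot g (actField_coeFn g y.2)] with x hx
      rw [push_snd, hx, rot_inv_rot, rotField_rot, LinearIsometryEquiv.inner_map_map]
      rfl

end WeakGradient

/-! ### The pointwise inequality -/

/-- Cauchy–Schwarz in the plane for `(√e, √f)` and `(√a, √b)`, free of square roots. -/
theorem sq_add_le_of_sq_le {p q e f a b : ℝ} (he : 0 ≤ e) (hf : 0 ≤ f) (ha : 0 ≤ a) (hb : 0 ≤ b)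
    (hp : p ^ 2 ≤ e * a) (hq : q ^ 2 ≤ f * b) : (p + q) ^ 2 ≤ (e + f) * (a + b) := by
  have h : 2 * (p * q) ≤ e * b + f * a := by
    refine le_of_abs_le (abs_le_of_sq_le_sq ?_ (by positivity))
    have h1 : (p * q) ^ 2 ≤ (e * a) * (f * b) := by
      rw [mul_pow]
      exact mul_le_mul hp hq (sq_nonneg _) (by positivity)
    nlinarith [sq_nonneg (e * b - f * a)]
  nlinarith

/-- The arithmetic–geometric mean inequality for `n f` and `Q / f`, whose product `n Q` dominates
`m²`; no division by `n`, which may vanish. -/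
theorem two_mul_sub_le_div {m n Q f : ℝ} (hn : 0 ≤ n) (hQ : 0 ≤ Q) (hf : 0 < f)
    (h : m ^ 2 ≤ n * Q) : 2 * m - n * f ≤ Q / f := by
  rw [le_div_iff₀ hf]
  have : 2 * m * f ≤ Q + n * f ^ 2 := by
    refine le_of_abs_le (abs_le_of_sq_le_sq ?_ (by positivity))
    nlinarith [sq_nonneg (Q - n * f ^ 2), mul_le_mul_of_nonneg_right h (sq_nonneg f)]
  nlinarith

/-- A vector `η` whose reservoir part is parallel to that of `y`, paired with a vector `ξ`
orthogonal to `y`, only sees the system part of `ξ` up to an error controlled by the system part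
of `y`. -/
theorem inner_sq_mul_norm_sq_le {M N : ℕ} {y η ξ : EuclideanSpace ℝ (Particles M N)}
    (hpar : ∀ i j : Fin N, y (.inr i) * η (.inr j) = y (.inr j) * η (.inr i))
    (horth : inner ℝ y ξ = 0) :
    inner ℝ η ξ ^ 2 * ‖y‖ ^ 2 ≤
      ‖η‖ ^ 2 * ∑ i : Fin M, (ξ (.inl i) ^ 2 * ‖y‖ ^ 2 + y (.inl i) ^ 2 * ‖ξ‖ ^ 2) := by
  simp only [EuclideanSpace.real_norm_sq_eq, PiLp.inner_apply, RCLike.inner_apply, conj_trivial,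
    Fintype.sum_sum_type, Finset.sum_add_distrib, ← Finset.sum_mul] at horth ⊢
  have he : 0 ≤ ∑ i : Fin M, η (.inl i) ^ 2 := Finset.sum_nonneg fun i _ => sq_nonneg _
  have hf : 0 ≤ ∑ i : Fin N, η (.inr i) ^ 2 := Finset.sum_nonneg fun i _ => sq_nonneg _
  have ha : 0 ≤ ∑ i : Fin M, ξ (.inl i) ^ 2 := Finset.sum_nonneg fun i _ => sq_nonneg _
  have hb : 0 ≤ ∑ i : Fin N, ξ (.inr i) ^ 2 := Finset.sum_nonneg fun i _ => sq_nonneg _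
  have hv : 0 ≤ ∑ i : Fin M, y (.inl i) ^ 2 := Finset.sum_nonneg fun i _ => sq_nonneg _
  have hw : 0 ≤ ∑ i : Fin N, y (.inr i) ^ 2 := Finset.sum_nonneg fun i _ => sq_nonneg _
  have hp : (∑ i : Fin M, ξ (.inl i) * η (.inl i)) ^ 2 ≤
      (∑ i : Fin M, η (.inl i) ^ 2) * ∑ i : Fin M, ξ (.inl i) ^ 2 :=
    (Finset.sum_mul_sq_le_sq_mul_sq _ _ _).trans (mul_comm _ _).le
  have hq : (∑ i : Fin N, ξ (.inr i) * η (.inr i)) ^ 2 ≤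
      (∑ i : Fin N, η (.inr i) ^ 2) * ∑ i : Fin N, ξ (.inr i) ^ 2 :=
    (Finset.sum_mul_sq_le_sq_mul_sq _ _ _).trans (mul_comm _ _).le
  have hs : (∑ i : Fin M, ξ (.inl i) * y (.inl i)) ^ 2 ≤
      (∑ i : Fin M, ξ (.inl i) ^ 2) * ∑ i : Fin M, y (.inl i) ^ 2 :=
    Finset.sum_mul_sq_le_sq_mul_sq _ _ _
  have ht : (∑ i : Fin N, ξ (.inr i) * y (.inr i)) ^ 2 ≤
      (∑ i : Fin N, ξ (.inr i) ^ 2) * ∑ i : Fin N, y (.inr i) ^ 2 :=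
    Finset.sum_mul_sq_le_sq_mul_sq _ _ _
  have h1 : (∑ i : Fin N, y (.inr i) ^ 2) * (∑ i : Fin N, ξ (.inr i) * η (.inr i)) =
      (∑ i : Fin N, y (.inr i) * η (.inr i)) * ∑ i : Fin N, ξ (.inr i) * y (.inr i) := by
    rw [Finset.sum_mul_sum, Finset.sum_mul_sum]
    refine Finset.sum_congr rfl fun i _ => Finset.sum_congr rfl fun j _ => ?_
    linear_combination (y (.inr i) * ξ (.inr j)) * hpar i j
  have h2 : (∑ i : Fin N, y (.inr i) ^ 2) * (∑ i : Fin N, η (.inr i) ^ 2) =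
      (∑ i : Fin N, y (.inr i) * η (.inr i)) ^ 2 := by
    rw [sq (Finset.sum _ _), Finset.sum_mul_sum, Finset.sum_mul_sum]
    refine Finset.sum_congr rfl fun i _ => Finset.sum_congr rfl fun j _ => ?_
    linear_combination (y (.inr i) * η (.inr j)) * hpar i j
  generalize (∑ i : Fin M, η (.inl i) ^ 2) = e at *
  generalize (∑ i : Fin N, η (.inr i) ^ 2) = f at *
  generalize (∑ i : Fin M, ξ (.inl i) ^ 2) = a at *
  generalize (∑ i : Fin N, ξ (.inr i) ^ 2) = b at *
  generalize (∑ i : Fin M, y (.inl i) ^ 2) = v at *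
  generalize (∑ i : Fin N, y (.inr i) ^ 2) = w at *
  generalize (∑ i : Fin M, ξ (.inl i) * η (.inl i)) = p at *
  generalize (∑ i : Fin N, ξ (.inr i) * η (.inr i)) = q at *
  generalize (∑ i : Fin M, ξ (.inl i) * y (.inl i)) = s at *
  generalize (∑ i : Fin N, ξ (.inr i) * y (.inr i)) = t at *
  generalize (∑ i : Fin N, y (.inr i) * η (.inr i)) = c at *
  -- If `w = 0`, the system part carries all of `‖y‖²` and plain Cauchy–Schwarz is enough.
  rcases hw.eq_or_lt with hw0 | hw0
  · subst hw0
    have := sq_add_le_of_sq_le he hf ha hb hp hq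
    have h3 : 0 ≤ (e + f) * a := by positivity
    nlinarith
  -- `t² / w` is the squared length of the component of `ξ` along the reservoir part of `y`, the
  -- only one that a parallel `η` can see.
  · have hq' : q ^ 2 ≤ f * (t ^ 2 / w) := by
      rw [← mul_div_assoc, le_div_iff₀ hw0]
      have : w * (q ^ 2 * w) = w * (f * t ^ 2) := by
        linear_combination (w * q + c * t) * h1 - t ^ 2 * h2
      exact (mul_left_cancel₀ hw0.ne' this).le
    have h3 := sq_add_le_of_sq_le he hf ha (by positivity) hp hq'
    -- Orthogonality gives `t = -s`, so `t²` has two bounds, `a v` and `b w`; the first is used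
    -- against `w`, the second against `v`.
    have h4 : t ^ 2 / w * (v + w) ≤ v * (a + b) := by
      rw [div_mul_eq_mul_div, div_le_iff₀ hw0]
      have : t ^ 2 = s ^ 2 := by
        have : t = -s := by linarith
        rw [this, neg_sq]
      nlinarith
    calc (p + q) ^ 2 * (v + w) ≤ (e + f) * (a + t ^ 2 / w) * (v + w) := by gcongr
      _ = (e + f) * (a * (v + w) + t ^ 2 / w * (v + w)) := by ring
      _ ≤ (e + f) * (a * (v + w) + v * (a + b)) := by gcongr

/-! ### A quadratic form attached to a function and its gradient -/

section Form

variable {ι : Type*} [Fintype ι] {r : ℝ}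

/-- The density, before division by the function, of the quadratic form `fisherForm`. -/
def fisherDensity (r : ℝ) (ξ x u v : EuclideanSpace ℝ ι) : ℝ :=
  inner ℝ u ξ * inner ℝ v ξ + inner ℝ u x * inner ℝ v x * ‖ξ‖ ^ 2 / r ^ 2

theorem abs_fisherDensity_le (hr : 0 < r) {x : EuclideanSpace ℝ ι} (hx : ‖x‖ = r)
    (ξ u v : EuclideanSpace ℝ ι) :
    |fisherDensity r ξ x u v| ≤ 2 * ‖u‖ * ‖v‖ * ‖ξ‖ ^ 2 := by
  have h1 : |inner ℝ u ξ * inner ℝ v ξ| ≤ ‖u‖ * ‖v‖ * ‖ξ‖ ^ 2 := by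
    rw [abs_mul]
    refine (mul_le_mul (abs_real_inner_le_norm u ξ) (abs_real_inner_le_norm v ξ) (abs_nonneg _)
      (by positivity)).trans_eq (by ring)
  have h2 : |inner ℝ u x * inner ℝ v x * ‖ξ‖ ^ 2 / r ^ 2| ≤ ‖u‖ * ‖v‖ * ‖ξ‖ ^ 2 := by
    rw [abs_div, abs_mul, abs_mul, abs_of_nonneg (sq_nonneg r), abs_of_nonneg (sq_nonneg ‖ξ‖),
      div_le_iff₀ (by positivity)]
    calc |inner ℝ u x| * |inner ℝ v x| * ‖ξ‖ ^ 2 ≤ (‖u‖ * ‖x‖) * (‖v‖ * ‖x‖) * ‖ξ‖ ^ 2 := by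
          gcongr <;> exact abs_real_inner_le_norm _ _
      _ = ‖u‖ * ‖v‖ * ‖ξ‖ ^ 2 * r ^ 2 := by rw [hx]; ring
  refine (abs_add_le _ _).trans ?_
  linarith

theorem integrable_fisherDensity (hr : 0 < r) {F : EuclideanSpace ℝ ι → ℝ}
    {G : EuclideanSpace ℝ ι → EuclideanSpace ℝ ι}
    (hF : AEStronglyMeasurable F (sphereMeasure ι r))
    (hG : AEStronglyMeasurable G (sphereMeasure ι r))
    (hI : Integrable (fun x => ‖G x‖ ^ 2 / F x) (sphereMeasure ι r)) (u v : EuclideanSpace ℝ ι) :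
    Integrable (fun x => fisherDensity r (G x) x u v / F x) (sphereMeasure ι r) := by
  refine (hI.const_mul (2 * ‖u‖ * ‖v‖)).mono (AEStronglyMeasurable.div₀ ?_ hF) ?_
  · unfold fisherDensity
    refine (((aestronglyMeasurable_const.inner hG).mul (aestronglyMeasurable_const.inner hG)).add
      ?_)
    simp only [div_eq_mul_inv]
    exact (((aestronglyMeasurable_const.inner aestronglyMeasurable_id).mul
      (aestronglyMeasurable_const.inner aestronglyMeasurable_id)).mul
      (hG.norm.pow 2)).mul_const _
  · filter_upwards [ae_norm_eq hr.le] with x hx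
    rw [norm_div, norm_mul, norm_div, Real.norm_of_nonneg (by positivity : 0 ≤ 2 * ‖u‖ * ‖v‖),
      Real.norm_of_nonneg (sq_nonneg _), ← mul_div_assoc]
    gcongr
    exact abs_fisherDensity_le hr hx _ _ _

/-- The bilinear form `∫ ((u·G)(v·G) + (u·x)(v·x)|G|²/r²) / F dσ`. -/
theorem exists_fisherForm (hr : 0 < r) {F : EuclideanSpace ℝ ι → ℝ}
    {G : EuclideanSpace ℝ ι → EuclideanSpace ℝ ι}
    (hF : AEStronglyMeasurable F (sphereMeasure ι r))
    (hG : AEStronglyMeasurable G (sphereMeasure ι r))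
    (hI : Integrable (fun x => ‖G x‖ ^ 2 / F x) (sphereMeasure ι r)) :
    ∃ b : LinearMap.BilinForm ℝ (EuclideanSpace ℝ ι), ∀ u v,
      b u v = ∫ x, fisherDensity r (G x) x u v / F x ∂(sphereMeasure ι r) := by
  have hint := integrable_fisherDensity hr hF hG hI
  refine ⟨LinearMap.mk₂ ℝ
    (fun u v => ∫ x, fisherDensity r (G x) x u v / F x ∂(sphereMeasure ι r)) ?_ ?_ ?_ ?_,
    fun u v => rfl⟩
  · intro u u' v
    rw [← integral_add (hint _ _) (hint _ _)]
    congr 1 with x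
    simp only [fisherDensity, inner_add_left]
    ring
  · intro c u v
    rw [smul_eq_mul, ← integral_const_mul]
    congr 1 with x
    simp only [fisherDensity, real_inner_smul_left]
    ring
  · intro u v v'
    rw [← integral_add (hint _ _) (hint _ _)]
    congr 1 with x
    simp only [fisherDensity, inner_add_left]
    ring
  · intro c u v
    rw [smul_eq_mul, ← integral_const_mul]
    congr 1 with x
    simp only [fisherDensity, real_inner_smul_left]
    ring

variable [DecidableEq ι]

/-- By Parseval each of the two terms of the density contributes `‖G‖²`, the second because `‖x‖² =
r²`. -/
theorem fisherForm_trace (hr : 0 < r) {F : EuclideanSpace ℝ ι → ℝ}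
    {G : EuclideanSpace ℝ ι → EuclideanSpace ℝ ι}
    (hF : AEStronglyMeasurable F (sphereMeasure ι r))
    (hG : AEStronglyMeasurable G (sphereMeasure ι r))
    (hI : Integrable (fun x => ‖G x‖ ^ 2 / F x) (sphereMeasure ι r))
    {b : LinearMap.BilinForm ℝ (EuclideanSpace ℝ ι)}
    (hb : ∀ u v, b u v = ∫ x, fisherDensity r (G x) x u v / F x ∂(sphereMeasure ι r)) :
    ∑ a, b (EuclideanSpace.single a 1) (EuclideanSpace.single a 1) =
      2 * ∫ x, ‖G x‖ ^ 2 / F x ∂(sphereMeasure ι r) := by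
  simp only [hb]
  rw [← integral_finsetSum _ fun a _ => integrable_fisherDensity hr hF hG hI _ _,
    ← integral_const_mul]
  refine integral_congr_ae ?_
  filter_upwards [ae_norm_eq hr.le] with x hx
  simp only [fisherDensity, EuclideanSpace.inner_single_left, map_one, one_mul]
  rw [← Finset.sum_div, Finset.sum_add_distrib, ← Finset.sum_div, ← Finset.sum_mul]
  simp only [← sq]
  rw [← EuclideanSpace.real_norm_sq_eq, ← EuclideanSpace.real_norm_sq_eq, hx,
    mul_div_cancel_left₀ _ (by positivity)]
  ring

end Form

/-! ### Bounds on functionals in terms of the quadratic form -/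

/-- After the change of variables `x ↦ g x`, the pointwise inequality at `g x` compares the
integrands. The field `h` belongs to the final pair and `y` is the initial one: only `h` needs the
symmetry, and the bound holds for every `g`. -/
theorem functional_push_le {M N : ℕ} {r : ℝ} (hr : 0 < r) {y : PairL1 (Particles M N) r}
    (hF : ∀ᵐ x ∂(sphereMeasure (Particles M N) r), 0 ≤ y.1 x)
    (hzero : ∀ᵐ x ∂(sphereMeasure (Particles M N) r), y.1 x = 0 → y.2 x = 0)
    (hI : Integrable (fun x => ‖y.2 x‖ ^ 2 / y.1 x) (sphereMeasure (Particles M N) r))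
    (htan : ∀ᵐ x ∂(sphereMeasure (Particles M N) r), inner ℝ x (y.2 x) = 0)
    {b : LinearMap.BilinForm ℝ (EuclideanSpace ℝ (Particles M N))}
    (hb : ∀ u v, b u v =
      ∫ x, fisherDensity r (y.2 x) x u v / y.1 x ∂(sphereMeasure (Particles M N) r))
    {h : EuclideanSpace ℝ (Particles M N) → EuclideanSpace ℝ (Particles M N)} {C : ℝ}
    (hh : AEStronglyMeasurable h (sphereMeasure (Particles M N) r))
    (hC : ∀ x, ‖h x‖ ≤ C)
    (hpar : ∀ᵐ x ∂(sphereMeasure (Particles M N) r), ∀ i j : Fin N,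
      x (.inr i) * h x (.inr j) = x (.inr j) * h x (.inr i))
    {l : PairL1 (Particles M N) r →L[ℝ] ℝ}
    (hl : ∀ z : PairL1 (Particles M N) r,
      l z = ∫ x, inner ℝ ((2 : ℝ) • h x) (z.2 x) ∂(sphereMeasure (Particles M N) r) +
        ∫ x, -‖h x‖ ^ 2 * z.1 x ∂(sphereMeasure (Particles M N) r))
    (g : orthogonalGroup (Particles M N) ℝ) :
    l (push g y) ≤ ∑ i : Fin M, b (rot g⁻¹ (EuclideanSpace.single (.inl i) 1))
      (rot g⁻¹ (EuclideanSpace.single (.inl i) 1)) := by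
  set s := sphereMeasure (Particles M N) r with hs
  have hmp : MeasurePreserving (rot g) s s := measurePreserving_isometry r (rot g)
  have hFm : AEStronglyMeasurable y.1 s := Lp.aestronglyMeasurable _
  have hGm : AEStronglyMeasurable y.2 s := Lp.aestronglyMeasurable _
  have hhg : AEStronglyMeasurable (fun x => h (rot g x)) s := hh.comp_measurePreserving hmp
  have hint1 : Integrable (fun x => inner ℝ ((2 : ℝ) • h (rot g x)) (rot g (y.2 x))) s := by
    refine integrable_inner_field (C := 2 * C) (hhg.const_smul (2 : ℝ)) (.of_forall fun x => ?_)
      ((rot g).toLinearIsometry.toContinuousLinearMap.integrable_comp (L1.integrable_coeFn y.2))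
    rw [norm_smul, Real.norm_two]
    exact mul_le_mul_of_nonneg_left (hC _) zero_le_two
  have hint2 : Integrable (fun x => -‖h (rot g x)‖ ^ 2 * y.1 x) s := by
    refine integrable_mul_fun (C := C ^ 2) (hhg.norm.pow 2).neg (.of_forall fun x => ?_)
      (L1.integrable_coeFn y.1)
    rw [norm_neg, norm_pow, norm_norm]
    exact pow_le_pow_left₀ (norm_nonneg _) (hC _) 2
  have e1 : l (push g y) = ∫ x, (inner ℝ ((2 : ℝ) • h (rot g x)) (rot g (y.2 x)) +
      -‖h (rot g x)‖ ^ 2 * y.1 x) ∂s := by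
    rw [hl, integral_add hint1 hint2, ← integral_comp_rot r g,
      ← integral_comp_rot r g (fun x => -‖h x‖ ^ 2 * _)]
    congr 1
    · refine integral_congr_ae ?_
      filter_upwards [ae_rot g (actField_coeFn g y.2)] with x hx
      rw [push_snd, hx, rot_inv_rot]
    · refine integral_congr_ae ?_
      filter_upwards [ae_rot g (act_coeFn g y.1)] with x hx
      rw [push_fst, hx, rot_inv_rot]
  have hd (u v) := integrable_fisherDensity hr hFm hGm hI u v
  rw [e1]
  simp only [hb]
  rw [← integral_finsetSum _ fun i _ => hd _ _]
  refine integral_mono_ae (hint1.add hint2) (integrable_finsetSum _ fun i _ => hd _ _) ?_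
  filter_upwards [hF, hzero, htan, ae_rot g hpar, ae_norm_eq hr.le] with x hx hx0 ht hp hn
  rcases hx.eq_or_lt with h0 | hpos
  -- Where the function vanishes so does the gradient, and both integrands are `0`.
  · simp [← h0, hx0 h0.symm]
  · have ho : inner ℝ (rot g x) (rot g (y.2 x)) = 0 := by
      rw [LinearIsometryEquiv.inner_map_map, ht]
    have key := inner_sq_mul_norm_sq_le hp ho
    have hin (z : EuclideanSpace ℝ (Particles M N)) (a : Particles M N) :
        inner ℝ (rot g⁻¹ (EuclideanSpace.single a 1)) z = rot g z a := by
      rw [inner_rot_left, inv_inv, EuclideanSpace.inner_single_left]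
      simp
    simp only [fisherDensity, hin]
    rw [← Finset.sum_div, real_inner_smul_left, neg_mul, ← sub_eq_add_neg]
    refine two_mul_sub_le_div (sq_nonneg _) (Finset.sum_nonneg fun i _ => ?_) hpos ?_
    · rw [← sq, ← sq]
      positivity
    · rw [LinearIsometryEquiv.norm_map, LinearIsometryEquiv.norm_map, hn] at key
      refine le_of_mul_le_mul_right (key.trans_eq ?_) (by positivity : 0 < r ^ 2)
      rw [mul_assoc, Finset.sum_mul]
      congr 1
      refine Finset.sum_congr rfl fun i _ => ?_
      field_simp

/-! ### Exponentials of bounded operators -/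

section Exp

variable {X Y : Type*} [NormedAddCommGroup X] [NormedSpace ℝ X] [CompleteSpace X]
  [NormedAddCommGroup Y] [NormedSpace ℝ Y] [CompleteSpace Y]

theorem hasSum_exp_apply (A : X →L[ℝ] X) (x : X) :
    HasSum (fun n : ℕ => ((n.factorial : ℝ)⁻¹) • (A ^ n) x) (NormedSpace.exp A x) := by
  have h : HasSum (fun n : ℕ => ((n.factorial : ℝ)⁻¹) • A ^ n) (NormedSpace.exp A) :=
    NormedSpace.exp_series_hasSum_exp' A
  have h' := (ContinuousLinearMap.apply ℝ X x).hasSum h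
  simpa only [ContinuousLinearMap.apply_apply, _root_.smul_apply] using h'

/-- Intertwining passes to powers and to the series. It is used with `T` the projection of pairs
onto functions. -/
theorem map_exp_apply {A : X →L[ℝ] X} {B : Y →L[ℝ] Y} (T : X →L[ℝ] Y)
    (h : ∀ x, T (A x) = B (T x)) (x : X) :
    T (NormedSpace.exp A x) = NormedSpace.exp B (T x) := by
  have hn (n : ℕ) : ∀ x, T ((A ^ n) x) = (B ^ n) (T x) := by
    induction n with
    | zero => simp
    | succ n ih =>
      intro x
      rw [pow_succ, pow_succ, mul_apply_eq_comp, mul_apply_eq_comp, ih, h]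
  refine (T.hasSum (hasSum_exp_apply A x)).unique ?_
  convert hasSum_exp_apply B (T x) using 2 with n
  rw [map_smul, hn]

theorem exp_apply_mem {A : X →L[ℝ] X} {W : Submodule ℝ X} (hW : IsClosed (W : Set X))
    (h : ∀ x ∈ W, A x ∈ W) {x : X} (hx : x ∈ W) : NormedSpace.exp A x ∈ W := by
  have hn (n : ℕ) : (A ^ n) x ∈ W := by
    induction n with
    | zero => simpa
    | succ n ih =>
      rw [pow_succ', mul_apply_eq_comp]
      exact h _ ih
  exact hW.mem_of_tendsto (hasSum_exp_apply A x)
    (.of_forall fun s => W.sum_mem fun n _ => W.smul_mem _ (hn n))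

/-- Splits off the loss term: for `t ≥ 0` the remaining series in the gain operator has nonnegative
coefficients, so that one-sided bounds on its powers can be summed. -/
theorem exp_smul_sub_smul_one (B : X →L[ℝ] X) (c t : ℝ) :
    NormedSpace.exp (t • (B - c • ContinuousLinearMap.id ℝ X)) =
      Real.exp (-(t * c)) • NormedSpace.exp (t • B) := by
  let +nondep : NormedAlgebra ℚ (X →L[ℝ] X) := .restrictScalars ℚ ℝ _
  have h : t • (B - c • ContinuousLinearMap.id ℝ X) =
      t • B + algebraMap ℝ (X →L[ℝ] X) (-(t * c)) := by
    rw [Algebra.algebraMap_eq_smul_one, ← ContinuousLinearMap.one_def]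
    module
  rw [h, NormedSpace.exp_add_of_commute (Algebra.commutes _ _).symm,
    ← NormedSpace.algebraMap_exp_comm, ← Real.exp_eq_exp_ℝ, Algebra.algebraMap_eq_smul_one,
    mul_smul_comm, mul_one]

end Exp

/-! ### Collisions of pairs -/

section Collision

variable {ι : Type*} [Fintype ι] [DecidableEq ι] {r : ℝ}

/-- The averaged collision operator on pairs. -/
def collisionPair (ν : Measure ℝ) [IsProbabilityMeasure ν] (i j : ι) :
    PairL1 ι r →L[ℝ] PairL1 ι r :=
  average ν ⟨planeRotation i j, continuous_planeRotation i j⟩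

theorem collisionPair_fst (ν : Measure ℝ) [IsProbabilityMeasure ν] (i j : ι) (y : PairL1 ι r) :
    (collisionPair ν i j y).1 = collision ν i j y.1 :=
  average_fst ν _ y

theorem rot_planeRotation_inv_single_left {i j : ι} (h : i ≠ j) (θ : ℝ) :
    rot (planeRotation i j θ)⁻¹ (EuclideanSpace.single i 1) =
      Real.cos θ • EuclideanSpace.single i 1 + Real.sin θ • EuclideanSpace.single j 1 := by
  ext k
  rw [rot_planeRotation_inv h]
  by_cases hi : k = i <;> by_cases hj : k = j <;> simp_all [h.symm]

theorem rot_planeRotation_inv_single_right {i j : ι} (h : i ≠ j) (θ : ℝ) :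
    rot (planeRotation i j θ)⁻¹ (EuclideanSpace.single j 1) =
      Real.cos θ • EuclideanSpace.single j 1 - Real.sin θ • EuclideanSpace.single i 1 := by
  ext k
  rw [rot_planeRotation_inv h]
  by_cases hi : k = i <;> by_cases hj : k = j <;> simp_all [h.symm]

theorem rot_planeRotation_inv_single_of_ne {i j a : ι} (h : i ≠ j) (hi : a ≠ i) (hj : a ≠ j)
    (θ : ℝ) :
    rot (planeRotation i j θ)⁻¹ (EuclideanSpace.single a 1) = EuclideanSpace.single a 1 := by
  ext k
  rw [rot_planeRotation_inv h]
  by_cases hi : k = i <;> by_cases hj : k = j <;> simp_all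

/-- The value of a quadratic form at a row of an orthogonal matrix. -/
def rowForm (b : LinearMap.BilinForm ℝ (EuclideanSpace ℝ ι)) (g : orthogonalGroup ι ℝ) (a : ι) :
    ℝ :=
  b (rot g⁻¹ (EuclideanSpace.single a 1)) (rot g⁻¹ (EuclideanSpace.single a 1))

/-- Left multiplication by a plane rotation changes only rows `i` and `j`, which become `cos θ` and
`± sin θ` combinations of each other. -/
theorem sum_rowForm_planeRotation_mul (b : LinearMap.BilinForm ℝ (EuclideanSpace ℝ ι))
    (g : orthogonalGroup ι ℝ) {i j : ι} (h : i ≠ j) (z : ι → ℝ) (θ : ℝ) :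
    ∑ a, z a * rowForm b (planeRotation i j θ * g) a =
      ∑ a, z a * rowForm b g a +
        (z j - z i) * (rowForm b g i - rowForm b g j) * Real.sin θ ^ 2 -
        (z j - z i) * (b (rot g⁻¹ (EuclideanSpace.single i 1))
          (rot g⁻¹ (EuclideanSpace.single j 1)) + b (rot g⁻¹ (EuclideanSpace.single j 1))
          (rot g⁻¹ (EuclideanSpace.single i 1))) * (Real.sin θ * Real.cos θ) := by
  rw [add_sub_assoc, ← sub_eq_iff_eq_add', ← Finset.sum_sub_distrib]
  rw [Fintype.sum_eq_add i j h fun a ha => ?_]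
  · simp only [rowForm, _root_.mul_inv_rev, rot_mul_apply, rot_planeRotation_inv_single_left h,
      rot_planeRotation_inv_single_right h, map_add, map_sub, map_smul, LinearMap.add_apply,
      LinearMap.sub_apply, LinearMap.smul_apply, smul_eq_mul]
    have := Real.sin_sq_add_cos_sq θ
    have hc : Real.cos θ ^ 2 = 1 - Real.sin θ ^ 2 := by linarith
    ring_nf
    rw [hc]
    ring
  · simp only [rowForm, _root_.mul_inv_rev, rot_mul_apply,
      rot_planeRotation_inv_single_of_ne h ha.1 ha.2, sub_self]

theorem integrable_sin_sq (ν : Measure ℝ) [IsFiniteMeasure ν] :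
    Integrable (fun θ => Real.sin θ ^ 2) ν :=
  Integrable.of_bound (C := 1) (by fun_prop) (.of_forall fun θ => by
    rw [Real.norm_of_nonneg (sq_nonneg _)]
    exact Real.sin_sq_le_one θ)

theorem integrable_sin_mul_cos (ν : Measure ℝ) [IsFiniteMeasure ν] :
    Integrable (fun θ => Real.sin θ * Real.cos θ) ν :=
  Integrable.of_bound (C := 1) (by fun_prop) (.of_forall fun θ => by
    rw [norm_mul]
    exact mul_le_one₀ (Real.abs_sin_le_one θ) (norm_nonneg _) (Real.abs_cos_le_one θ))

/-- The collision replaces `g` by `r_{ij}(θ) g`, so the assumed bound is used at all these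
rotations. The hypothesis `hν` cancels the mixed terms `b(u, v) + b(v, u)`, which have no sign. -/
theorem apply_collisionPair_le {ν : Measure ℝ} [IsProbabilityMeasure ν]
    (hν : ∫ θ, Real.sin θ * Real.cos θ ∂ν = 0)
    {b : LinearMap.BilinForm ℝ (EuclideanSpace ℝ ι)} {y : PairL1 ι r}
    {l : PairL1 ι r →L[ℝ] ℝ} {z : ι → ℝ}
    (hl : ∀ g, l (push g y) ≤ ∑ a, z a * rowForm b g a) {i j : ι} (h : i ≠ j)
    (g : orthogonalGroup ι ℝ) :
    l (collisionPair ν i j (push g y)) ≤ ∑ a, z a * rowForm b g a +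
      (z j - z i) * (rowForm b g i - rowForm b g j) * ∫ θ, Real.sin θ ^ 2 ∂ν := by
  have h1 := (integrable_sin_sq ν).const_mul ((z j - z i) * (rowForm b g i - rowForm b g j))
  have h2 := (integrable_sin_mul_cos ν).const_mul
    ((z j - z i) * (b (rot g⁻¹ (EuclideanSpace.single i 1))
          (rot g⁻¹ (EuclideanSpace.single j 1)) + b (rot g⁻¹ (EuclideanSpace.single j 1))
          (rot g⁻¹ (EuclideanSpace.single i 1))))
  rw [collisionPair, apply_average]
  refine (integral_mono (l.integrable_comp (integrable_push ν
    (continuous_planeRotation i j) _)) (((integrable_const (∑ a, z a * rowForm b g a)).add h1).sub h2)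
    fun θ => ?_).trans_eq ?_
  · change l (push (planeRotation i j θ) (push g y)) ≤ _
    rw [← push_mul]
    exact (hl _).trans_eq (sum_rowForm_planeRotation_mul b g h z θ)
  · rw [integral_sub' ((integrable_const _).add h1) h2, integral_add' (integrable_const _) h1,
      integral_const_mul, integral_const_mul, hν, mul_zero, sub_zero, integral_const]
    simp

end Collision

/-! ### The evolution of pairs -/

section Evolution

variable {M N : ℕ}

/-- The rate of the collisions of two particles. -/
def rate (M N : ℕ) (lamS lamR mu : ℝ) : Particles M N → Particles M N → ℝ
  | .inl i, .inl j => if i < j then lamS / ((M : ℝ) - 1) else 0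
  | .inl _, .inr _ => mu / N
  | .inr _, .inl _ => 0
  | .inr i, .inr j => if i < j then lamR / ((N : ℝ) - 1) else 0

theorem sum_ite_lt_smul {n : ℕ} {V : Type*} [AddCommGroup V] [Module ℝ V] (c : ℝ)
    (f : Fin n → Fin n → V) :
    ∑ i, ∑ j, (if i < j then c else 0) • f i j = c • ∑ i, ∑ j ∈ Finset.Ioi i, f i j := by
  rw [Finset.smul_sum]
  refine Finset.sum_congr rfl fun i _ => ?_
  rw [Finset.smul_sum]
  simp only [ite_smul, zero_smul]
  rw [← Finset.sum_filter]
  exact Finset.sum_congr (by ext; simp) fun _ _ => rfl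

theorem generator_eq_sum (lamS lamR mu : ℝ) (ν : Measure ℝ) [IsProbabilityMeasure ν] :
    generator M N lamS lamR mu ν =
      ∑ a, ∑ b, rate M N lamS lamR mu a b • (collision ν a b - 1) := by
  simp only [Fintype.sum_sum_type, rate, zero_smul, Finset.sum_const_zero,
    Finset.sum_add_distrib, sum_ite_lt_smul]
  rw [generator]
  simp only [Finset.smul_sum]
  abel

theorem rate_nonneg (hM : 1 ≤ M) (hN : 1 ≤ N) {lamS lamR mu : ℝ} (hlamS : 0 ≤ lamS)
    (hlamR : 0 ≤ lamR) (hmu : 0 ≤ mu) (a b : Particles M N) : 0 ≤ rate M N lamS lamR mu a b := by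
  have hM' : (0 : ℝ) ≤ (M : ℝ) - 1 := sub_nonneg.2 (by exact_mod_cast hM)
  have hN' : (0 : ℝ) ≤ (N : ℝ) - 1 := sub_nonneg.2 (by exact_mod_cast hN)
  rcases a with i | i <;> rcases b with j | j <;> simp only [rate] <;> try split_ifs
  all_goals positivity

theorem rate_self (lamS lamR mu : ℝ) (a : Particles M N) : rate M N lamS lamR mu a a = 0 := by
  rcases a with i | i <;> simp [rate]

/-- The gain part of the generator, on pairs. -/
def gainPair (M N : ℕ) (lamS lamR mu : ℝ) (ν : Measure ℝ) [IsProbabilityMeasure ν] (r : ℝ) :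
    PairL1 (Particles M N) r →L[ℝ] PairL1 (Particles M N) r :=
  ∑ a, ∑ b, rate M N lamS lamR mu a b • collisionPair ν a b

/-- The total collision rate. -/
def totalRate (M N : ℕ) (lamS lamR mu : ℝ) : ℝ := ∑ a, ∑ b, rate M N lamS lamR mu a b

/-- The generator of the evolution, on pairs. -/
def generatorPair (M N : ℕ) (lamS lamR mu : ℝ) (ν : Measure ℝ) [IsProbabilityMeasure ν] (r : ℝ) :
    PairL1 (Particles M N) r →L[ℝ] PairL1 (Particles M N) r :=
  gainPair M N lamS lamR mu ν r -
    totalRate M N lamS lamR mu • ContinuousLinearMap.id ℝ (PairL1 (Particles M N) r)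

theorem generatorPair_fst (lamS lamR mu : ℝ) (ν : Measure ℝ) [IsProbabilityMeasure ν]
    (y : PairL1 (Particles M N) (Real.sqrt (M + N))) :
    (generatorPair M N lamS lamR mu ν (Real.sqrt (M + N)) y).1 =
      generator M N lamS lamR mu ν y.1 := by
  rw [generator_eq_sum, generatorPair, gainPair, totalRate]
  simp only [_root_.sub_apply, _root_.sum_apply, _root_.smul_apply, Prod.fst_sub, Prod.fst_sum,
    Prod.smul_fst, collisionPair_fst, ContinuousLinearMap.id_apply, one_apply_eq_self, smul_sub,
    Finset.sum_sub_distrib, Finset.sum_smul]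

/-- One step of the two-state dynamics of the weights. Each system index meets `N` partners at rate
`mu / N`, each reservoir index meets `M`: hence the factors `1` and `M / N`. -/
theorem apply_gainPair_le {lamS lamR mu : ℝ} (hM : 1 ≤ M) (hN : 1 ≤ N) (hlamS : 0 ≤ lamS)
    (hlamR : 0 ≤ lamR) (hmu : 0 ≤ mu) {ν : Measure ℝ} [IsProbabilityMeasure ν]
    (hν : ∫ θ, Real.sin θ * Real.cos θ ∂ν = 0) {r : ℝ}
    {b : LinearMap.BilinForm ℝ (EuclideanSpace ℝ (Particles M N))}
    {y : PairL1 (Particles M N) r} {l : PairL1 (Particles M N) r →L[ℝ] ℝ} {α β : ℝ}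
    (hl : ∀ g, l (push g y) ≤ α * ∑ i, rowForm b g (.inl i) + β * ∑ j, rowForm b g (.inr j))
    (g : orthogonalGroup (Particles M N) ℝ) :
    l (gainPair M N lamS lamR mu ν r (push g y)) ≤
      (totalRate M N lamS lamR mu * α + mu * (∫ θ, Real.sin θ ^ 2 ∂ν) * (β - α)) *
          ∑ i, rowForm b g (.inl i) +
        (totalRate M N lamS lamR mu * β + mu * (∫ θ, Real.sin θ ^ 2 ∂ν) * (M / N) * (α - β)) *
          ∑ j, rowForm b g (.inr j) := by
  set s := ∫ θ, Real.sin θ ^ 2 ∂ν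
  let z : Particles M N → ℝ := Sum.elim (fun _ => α) fun _ => β
  have hz (g) : ∑ a, z a * rowForm b g a =
      α * ∑ i, rowForm b g (.inl i) + β * ∑ j, rowForm b g (.inr j) := by
    simp [z, Fintype.sum_sum_type, Finset.mul_sum]
  have hl' (g) : l (push g y) ≤ ∑ a, z a * rowForm b g a := (hl g).trans_eq (hz g).symm
  have hstep (a c : Particles M N) :
      rate M N lamS lamR mu a c * l (collisionPair ν a c (push g y)) ≤
      rate M N lamS lamR mu a c * (∑ a, z a * rowForm b g a) + rate M N lamS lamR mu a c *
        ((z c - z a) * (rowForm b g a - rowForm b g c) * s) := by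
    rw [← mul_add]
    by_cases hac : a = c
    · subst hac
      simp [rate_self]
    · exact mul_le_mul_of_nonneg_left (apply_collisionPair_le hν hl' hac g)
        (rate_nonneg hM hN hlamS hlamR hmu a c)
  simp only [gainPair, _root_.sum_apply, _root_.smul_apply, map_sum, map_smul, smul_eq_mul]
  refine (Finset.sum_le_sum fun a _ => Finset.sum_le_sum fun c _ => hstep a c).trans_eq ?_
  simp only [Finset.sum_add_distrib, ← Finset.sum_mul]
  rw [hz, ← totalRate]
  have hN0 : (N : ℝ) ≠ 0 := by
    have : N ≠ 0 := by omega
    exact_mod_cast this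
  -- The weights `z` are constant on the system and on the reservoir, so only collisions between the
  -- two contribute.
  have e : ∑ a, ∑ c, rate M N lamS lamR mu a c *
      ((z c - z a) * (rowForm b g a - rowForm b g c) * s) =
      mu / N * ((β - α) * (N * (∑ i, rowForm b g (.inl i)) -
        M * ∑ j, rowForm b g (.inr j)) * s) := by
    simp only [Fintype.sum_sum_type, rate, z, Sum.elim_inl, Sum.elim_inr, sub_self, zero_mul,
      mul_zero, Finset.sum_const_zero, zero_add, add_zero]
    simp only [← Finset.mul_sum, ← Finset.sum_mul, Finset.sum_sub_distrib, Finset.sum_const,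
      Finset.card_univ, Fintype.card_fin, nsmul_eq_mul]
  rw [e]
  field_simp
  ring

/-- The step on `(α, β)` has eigenvectors `(1, 1)` and `(N, -M)`, with eigenvalues `C` and `D`; the
initial weights are `(1, 0) = (M (1, 1) + (N, -M)) / (M + N)`. -/
theorem apply_gainPair_pow_le {lamS lamR mu : ℝ} (hM : 1 ≤ M) (hN : 1 ≤ N) (hlamS : 0 ≤ lamS)
    (hlamR : 0 ≤ lamR) (hmu : 0 ≤ mu) {ν : Measure ℝ} [IsProbabilityMeasure ν]
    (hν : ∫ θ, Real.sin θ * Real.cos θ ∂ν = 0) {r : ℝ}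
    {b : LinearMap.BilinForm ℝ (EuclideanSpace ℝ (Particles M N))}
    {y : PairL1 (Particles M N) r} {l : PairL1 (Particles M N) r →L[ℝ] ℝ}
    (hl : ∀ g, l (push g y) ≤ ∑ i, rowForm b g (.inl i)) (n : ℕ) {C D : ℝ}
    (hC : totalRate M N lamS lamR mu = C)
    (hD : C - mu * (∫ θ, Real.sin θ ^ 2 ∂ν) * ((M + N : ℝ) / N) = D)
    (g : orthogonalGroup (Particles M N) ℝ) :
    l ((gainPair M N lamS lamR mu ν r ^ n) (push g y)) ≤
      (M / (M + N) * C ^ n + N / (M + N) * D ^ n) * ∑ i, rowForm b g (.inl i) +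
        (M / (M + N) * C ^ n - M / (M + N) * D ^ n) * ∑ j, rowForm b g (.inr j) := by
  have hN0 : (0 : ℝ) < N := by exact_mod_cast hN
  have hMN : (0 : ℝ) < M + N := by positivity
  induction n generalizing g with
  | zero =>
    simp only [pow_zero, mul_one, one_apply_eq_self, sub_self, zero_mul, add_zero]
    rw [← add_div, div_self hMN.ne', one_mul]
    exact hl g
  | succ n ih =>
    -- The new factor acts first, so the induction hypothesis, valid for all `g`, is the assumed
    -- bound for the functional `l ∘ gainPair ^ n`.
    rw [pow_succ, mul_apply_eq_comp]
    refine (apply_gainPair_le hM hN hlamS hlamR hmu hν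
      (l := l.comp (gainPair M N lamS lamR mu ν r ^ n)) ih g).trans_eq ?_
    rw [hC, pow_succ, pow_succ, ← hD]
    field_simp
    ring

theorem apply_exp_generatorPair_le {lamS lamR mu : ℝ} (hM : 1 ≤ M) (hN : 1 ≤ N) (hlamS : 0 ≤ lamS)
    (hlamR : 0 ≤ lamR) (hmu : 0 ≤ mu) {ν : Measure ℝ} [IsProbabilityMeasure ν]
    (hν : ∫ θ, Real.sin θ * Real.cos θ ∂ν = 0) {r : ℝ}
    {b : LinearMap.BilinForm ℝ (EuclideanSpace ℝ (Particles M N))}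
    {y : PairL1 (Particles M N) r} {l : PairL1 (Particles M N) r →L[ℝ] ℝ}
    (hl : ∀ g, l (push g y) ≤ ∑ i, rowForm b g (.inl i)) {t : ℝ} (ht : 0 ≤ t) {e : ℝ}
    (he : Real.exp (-(mu * (∫ θ, Real.sin θ ^ 2 ∂ν) * ((M + N : ℝ) / N) * t)) = e) :
    l (NormedSpace.exp (t • generatorPair M N lamS lamR mu ν r) y) ≤
      (M / (M + N) + e * (N / (M + N))) * ∑ i, rowForm b 1 (.inl i) +
        (M / (M + N) - e * (M / (M + N))) * ∑ j, rowForm b 1 (.inr j) := by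
  set C := totalRate M N lamS lamR mu with hC
  set k := mu * (∫ θ, Real.sin θ ^ 2 ∂ν) * ((M + N : ℝ) / N)
  have hexp (x : ℝ) : HasSum (fun n : ℕ => (n.factorial : ℝ)⁻¹ * (t * x) ^ n)
      (Real.exp (t * x)) := by
    rw [Real.exp_eq_exp_ℝ]
    exact NormedSpace.exp_series_hasSum_exp' (𝕂 := ℝ) (t * x)
  have hL := l.hasSum (hasSum_exp_apply (t • gainPair M N lamS lamR mu ν r) y)
  have hR := ((((hexp C).mul_left ((M : ℝ) / (M + N))).add
      ((hexp (C - k)).mul_left ((N : ℝ) / (M + N)))).mul_right (∑ i, rowForm b 1 (.inl i))).add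
    ((((hexp C).mul_left ((M : ℝ) / (M + N))).sub
      ((hexp (C - k)).mul_left ((M : ℝ) / (M + N)))).mul_right (∑ j, rowForm b 1 (.inr j)))
  have hle := hasSum_le (fun n => ?_) hL hR
  · rw [generatorPair, exp_smul_sub_smul_one, _root_.smul_apply, map_smul, smul_eq_mul]
    refine (mul_le_mul_of_nonneg_left hle (Real.exp_nonneg _)).trans_eq ?_
    have e1 : Real.exp (-(t * C)) * Real.exp (t * C) = 1 := by
      rw [← Real.exp_add, neg_add_cancel, Real.exp_zero]
    have e2 : Real.exp (-(t * C)) * Real.exp (t * (C - k)) = e := by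
      rw [← Real.exp_add, ← he]
      congr 1
      ring
    set P := ∑ i, rowForm b 1 (.inl i)
    set Q := ∑ j, rowForm b 1 (.inr j)
    -- The eigenvalue `C` is exactly compensated by the loss factor; `C - k` leaves `e`.
    linear_combination (M / (M + N) * P + M / (M + N) * Q) * e1 +
      (N / (M + N) * P - M / (M + N) * Q) * e2
  · rw [smul_pow, _root_.smul_apply, map_smul, map_smul, smul_eq_mul, smul_eq_mul]
    have h := apply_gainPair_pow_le hM hN hlamS hlamR hmu hν hl n hC.symm rfl 1
    rw [push_one] at h
    refine (mul_le_mul_of_nonneg_left (mul_le_mul_of_nonneg_left h (pow_nonneg ht n))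
      (by positivity : (0 : ℝ) ≤ (n.factorial : ℝ)⁻¹)).trans_eq ?_
    rw [mul_pow, mul_pow]
    ring

theorem smul_generatorPair_mem {lamS lamR mu : ℝ} {ν : Measure ℝ} [IsProbabilityMeasure ν] {r : ℝ}
    (hr : 0 ≤ r) {y : PairL1 (Particles M N) r} (hy : y ∈ weakGradients hr) (t : ℝ) :
    (t • generatorPair M N lamS lamR mu ν r) y ∈ weakGradients hr := by
  rw [_root_.smul_apply, generatorPair, _root_.sub_apply, gainPair]
  refine Submodule.smul_mem _ _ (Submodule.sub_mem _ ?_ (Submodule.smul_mem _ _ hy))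
  simp only [_root_.sum_apply]
  refine Submodule.sum_mem _ fun a _ => Submodule.sum_mem _ fun d _ => Submodule.smul_mem _ _ ?_
  exact average_mem ν _ (isClosed_weakGradients hr) (fun g _ => push_mem_weakGradients hr g) hy

end Evolution

/-! ### Rotations of the reservoir -/

section Reservoir

instance instIsProbabilityMeasureHaarSO (n : Type*) [Fintype n] [DecidableEq n] :
    IsProbabilityMeasure (haarSO n) :=
  ⟨Measure.haarMeasure_self⟩

instance instIsMulLeftInvariantHaarSO (n : Type*) [Fintype n] [DecidableEq n] :
    (haarSO n).IsMulLeftInvariant :=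
  inferInstanceAs (Measure.haarMeasure ⊤).IsMulLeftInvariant

variable {M N : ℕ}

theorem continuous_reservoirRotation :
    Continuous (reservoirRotation : specialOrthogonalGroup (Fin N) ℝ →
      orthogonalGroup (Particles M N) ℝ) :=
  Continuous.subtype_mk (Continuous.matrix_fromBlocks continuous_const continuous_const
    continuous_const continuous_subtype_val) _

theorem reservoirRotation_mul (S T : specialOrthogonalGroup (Fin N) ℝ) :
    (reservoirRotation (S * T) : orthogonalGroup (Particles M N) ℝ) =
      reservoirRotation S * reservoirRotation T := by
  refine Subtype.ext ?_
  change fromBlocks 1 0 0 _ = fromBlocks 1 0 0 _ * fromBlocks 1 0 0 _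
  rw [fromBlocks_multiply]
  simp

theorem rot_reservoirRotation_inv_single (S : specialOrthogonalGroup (Fin N) ℝ) (i : Fin M) :
    rot (reservoirRotation S : orthogonalGroup (Particles M N) ℝ)⁻¹
      (EuclideanSpace.single (.inl i) 1) = EuclideanSpace.single (.inl i) 1 := by
  have h : rot (reservoirRotation S : orthogonalGroup (Particles M N) ℝ)
      (EuclideanSpace.single (.inl i) 1) = EuclideanSpace.single (.inl i) 1 := by
    ext k
    rw [rot_apply]
    rcases k with k | k <;> simp [reservoirRotation, Matrix.one_apply]
  conv_lhs => rw [← h]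
  rw [rot_inv_rot]

theorem rowForm_reservoirRotation_mul
    (b : LinearMap.BilinForm ℝ (EuclideanSpace ℝ (Particles M N)))
    (S : specialOrthogonalGroup (Fin N) ℝ) (g : orthogonalGroup (Particles M N) ℝ) (i : Fin M) :
    rowForm b (reservoirRotation S * g) (.inl i) = rowForm b g (.inl i) := by
  rw [rowForm, _root_.mul_inv_rev, rot_mul_apply, rot_reservoirRotation_inv_single, rowForm]

theorem planeMatrix_eq_sq {ι : Type*} [Fintype ι] [DecidableEq ι] {i j : ι} (h : i ≠ j) (θ : ℝ) :
    planeMatrix i j θ = planeMatrix i j (θ / 2) * planeMatrix i j (θ / 2) := by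
  have hs : Real.sin θ = 2 * Real.sin (θ / 2) * Real.cos (θ / 2) := by
    rw [← Real.sin_two_mul, mul_div_cancel₀ _ two_ne_zero]
  have hc : Real.cos θ = Real.cos (θ / 2) ^ 2 - Real.sin (θ / 2) ^ 2 := by
    rw [← Real.cos_two_mul', mul_div_cancel₀ _ two_ne_zero]
  have h' := h.symm
  ext a b
  change _ = planeMatrix i j (θ / 2) a ⬝ᵥ fun k => planeMatrix i j (θ / 2) k b
  by_cases hai : a = i <;> by_cases haj : a = j <;> by_cases hbi : b = i <;>
    by_cases hbj : b = j <;>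
    simp_all [planeMatrix, Pi.single_apply, add_dotProduct] <;> ring

/-- The rotation is the square of the one by half the angle, whose determinant squares to `1` by
orthogonality. -/
theorem det_planeMatrix {ι : Type*} [Fintype ι] [DecidableEq ι] {i j : ι} (h : i ≠ j) (θ : ℝ) :
    (planeMatrix i j θ).det = 1 := by
  have h1 := congrArg Matrix.det ((mem_orthogonalGroup_iff _ _).1 (planeMatrix_mem h (θ / 2)))
  rw [det_mul, det_transpose, det_one] at h1
  rw [planeMatrix_eq_sq h, det_mul, h1]

theorem exists_reservoirRotation_eq {i j : Fin N} (h : i ≠ j) (θ : ℝ) :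
    ∃ S : specialOrthogonalGroup (Fin N) ℝ,
      (reservoirRotation S : orthogonalGroup (Particles M N) ℝ) =
        planeRotation (.inr i) (.inr j) θ := by
  refine ⟨⟨planeMatrix i j θ, mem_specialOrthogonalGroup_iff.2
    ⟨planeMatrix_mem h θ, det_planeMatrix h θ⟩⟩, Subtype.ext ?_⟩
  rw [planeRotation, dif_pos (by simpa using h)]
  change fromBlocks 1 0 0 (planeMatrix i j θ) = planeMatrix (.inr i) (.inr j) θ
  ext a c
  rcases a with a | a <;> rcases c with c | c
  · simp [planeMatrix, Matrix.one_apply, Pi.single_apply, eq_comm]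
  · simp [planeMatrix]
  · by_cases hi : a = i <;> by_cases hj : a = j <;> simp_all [planeMatrix]
  · by_cases hi : a = i <;> by_cases hj : a = j <;> simp_all [planeMatrix, Pi.single_apply]

/-- The marginal, on pairs. -/
def marginalPair {r : ℝ} : PairL1 (Particles M N) r →L[ℝ] PairL1 (Particles M N) r :=
  average (haarSO (Fin N)) ⟨reservoirRotation, continuous_reservoirRotation⟩

theorem marginalPair_fst (y : PairL1 (Particles M N) (Real.sqrt (M + N))) :
    (marginalPair y).1 = marginal y.1 :=
  average_fst (haarSO (Fin N)) _ y

/-- Left invariance of Haar measure absorbs `T`. -/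
theorem push_marginalPair {r : ℝ} (T : specialOrthogonalGroup (Fin N) ℝ)
    (y : PairL1 (Particles M N) r) :
    push (reservoirRotation T) (marginalPair y) = marginalPair y := by
  have h := integrable_push (haarSO (Fin N))
    (continuous_reservoirRotation (M := M) (N := N)) y
  rw [marginalPair, average_apply]
  refine ((push (reservoirRotation T)).integral_comp_comm h).symm.trans ?_
  change ∫ S, push (reservoirRotation T) (push (reservoirRotation S) y) ∂(haarSO (Fin N)) = _
  simp only [← push_mul, ← reservoirRotation_mul]
  exact integral_mul_left_eq_self (μ := haarSO (Fin N))
    (fun S => push (reservoirRotation S) y) T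

end Reservoir

/-! ### Weak gradients of invariant functions -/

section Invariant

variable {ι : Type*} [Fintype ι] [DecidableEq ι] {r : ℝ}

theorem rot_planeRotation_inv_eq {i j : ι} (h : i ≠ j) (θ : ℝ) (x : EuclideanSpace ℝ ι) :
    rot (planeRotation i j θ)⁻¹ x =
      x + (x i * Real.cos θ - x j * Real.sin θ - x i) • EuclideanSpace.single i 1 +
        (x i * Real.sin θ + x j * Real.cos θ - x j) • EuclideanSpace.single j 1 := by
  ext k
  rw [rot_planeRotation_inv h]
  by_cases hi : k = i <;> by_cases hj : k = j <;> simp_all [h.symm]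

theorem hasDerivAt_rot_planeRotation_inv {i j : ι} (h : i ≠ j) (θ : ℝ)
    (x : EuclideanSpace ℝ ι) :
    HasDerivAt (fun θ => rot (planeRotation i j θ)⁻¹ x)
      (rotField i j (rot (planeRotation i j θ)⁻¹ x)) θ := by
  have e : rotField i j (rot (planeRotation i j θ)⁻¹ x) =
      (x i * -Real.sin θ - x j * Real.cos θ) • EuclideanSpace.single i 1 +
        (x i * Real.cos θ + x j * -Real.sin θ) • EuclideanSpace.single j 1 := by
    rw [rotField, rot_planeRotation_inv h, rot_planeRotation_inv h, if_pos rfl, if_neg h.symm,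
      if_pos rfl]
    module
  rw [e]
  simp only [rot_planeRotation_inv_eq h]
  have h1 := (((Real.hasDerivAt_cos θ).const_mul (x i)).sub
    ((Real.hasDerivAt_sin θ).const_mul (x j))).sub_const (x i)
  have h2 := (((Real.hasDerivAt_sin θ).const_mul (x i)).add
    ((Real.hasDerivAt_cos θ).const_mul (x j))).sub_const (x j)
  exact ((h1.smul_const (EuclideanSpace.single i (1 : ℝ))).const_add x).add
    (h2.smul_const (EuclideanSpace.single j (1 : ℝ)))

/-- Invariance makes `θ ↦ ∫ F(x) φ(r_{ij}(θ)⁻¹x) dσ` constant; the integral in question is its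
derivative at `0`. -/
theorem integral_fderiv_rotField_eq_zero (hr : 0 ≤ r) {i j : ι} (h : i ≠ j) {F : SphereL1 ι r}
    (hinv : ∀ θ, act (planeRotation i j θ) F = F) {φ : EuclideanSpace ℝ ι → ℝ}
    (hφ : ContDiff ℝ ∞ φ) :
    ∫ x, F x * fderiv ℝ φ x (rotField i j x) ∂(sphereMeasure ι r) = 0 := by
  have hFi : Integrable F (sphereMeasure ι r) := L1.integrable_coeFn F
  have hconst (θ : ℝ) : ∫ x, F x * φ (rot (planeRotation i j θ)⁻¹ x) ∂(sphereMeasure ι r) =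
      ∫ x, F x * φ x ∂(sphereMeasure ι r) := by
    rw [← integral_comp_rot r (planeRotation i j θ)⁻¹ fun x => F x * φ x]
    refine integral_congr_ae ?_
    filter_upwards [act_coeFn (planeRotation i j θ) F] with x hx
    rw [← hx, hinv]
  obtain ⟨C, hC⟩ := (isCompact_closedBall (0 : EuclideanSpace ℝ ι) r).exists_bound_of_continuousOn
    (continuous_fderiv_rotField hφ i j).continuousOn
  have hb : ∃ B, ∀ᵐ x ∂(sphereMeasure ι r), ‖φ x‖ ≤ B :=
    exists_bound_of_continuous hr hφ.continuous
  obtain ⟨B, hB⟩ := hb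
  have h0 (x : EuclideanSpace ℝ ι) : rot (planeRotation i j 0)⁻¹ x = x := by
    rw [rot_planeRotation_inv_eq h]
    simp
  have hd := (hasDerivAt_integral_of_dominated_loc_of_deriv_le (μ := sphereMeasure ι r)
    (F := fun θ x => F x * φ (rot (planeRotation i j θ)⁻¹ x))
    (F' := fun θ x => F x * fderiv ℝ φ (rot (planeRotation i j θ)⁻¹ x)
      (rotField i j (rot (planeRotation i j θ)⁻¹ x)))
    (bound := fun x => ‖F x‖ * C) (x₀ := (0 : ℝ)) Filter.univ_mem
    (.of_forall fun θ => hFi.aestronglyMeasurable.mul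
      (hφ.continuous.comp (rot _).continuous).aestronglyMeasurable) ?_
    (hFi.aestronglyMeasurable.mul ((continuous_fderiv_rotField hφ i j).comp
      (rot _).continuous).aestronglyMeasurable) ?_ (hFi.norm.mul_const C) ?_).2
  · simp only [hconst, h0] at hd
    exact hd.unique (hasDerivAt_const (0 : ℝ) _)
  · simp only [h0]
    simpa only [mul_comm] using integrable_mul_fun hφ.continuous.aestronglyMeasurable hB hFi
  · filter_upwards [ae_norm_eq hr] with x hx θ _
    rw [norm_mul]
    refine mul_le_mul_of_nonneg_left (hC _ ?_) (norm_nonneg _)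
    rw [mem_closedBall_zero_iff, LinearIsometryEquiv.norm_map, hx]
  · refine .of_forall fun x θ _ => ?_
    exact (((hφ.differentiable (by simp) _).hasFDerivAt.comp_hasDerivAt θ
      (hasDerivAt_rot_planeRotation_inv h θ x)).const_mul (F x))

theorem inner_rotField_ae_eq_zero (hr : 0 ≤ r) {i j : ι} (h : i ≠ j) {F : SphereL1 ι r}
    (hinv : ∀ θ, act (planeRotation i j θ) F = F)
    {G : EuclideanSpace ℝ ι → EuclideanSpace ℝ ι} (hG : IsWeakGradient r F G) :
    ∀ᵐ x ∂(sphereMeasure ι r), inner ℝ (rotField i j x) (G x) = 0 := by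
  obtain ⟨C, hC⟩ := exists_bound_of_continuous hr (continuous_rotField i j)
  refine ae_eq_zero_of_integral_contDiff_smul_eq_zero
    (integrable_inner_field (continuous_rotField i j).aestronglyMeasurable hC
      hG.integrable).locallyIntegrable fun φ hφ _ => ?_
  have := hG.integral_eq i j φ hφ
  rw [integral_fderiv_rotField_eq_zero hr h hinv hφ] at this
  simpa using this.symm

/-- The gradient is orthogonal to the generators of all rotations leaving `F` unchanged; for the
planes of the reservoir this says that its reservoir part is parallel to `w`. -/
theorem parallel_of_invariant {M N : ℕ} (hr : 0 ≤ r) {F : SphereL1 (Particles M N) r}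
    (hinv : ∀ S, act (reservoirRotation S) F = F)
    {G : EuclideanSpace ℝ (Particles M N) → EuclideanSpace ℝ (Particles M N)}
    (hG : IsWeakGradient r F G) :
    ∀ᵐ x ∂(sphereMeasure (Particles M N) r), ∀ i j : Fin N,
      x (.inr i) * G x (.inr j) = x (.inr j) * G x (.inr i) := by
  refine ae_all_iff.2 fun i => ae_all_iff.2 fun j => ?_
  by_cases hij : i = j
  · subst hij
    exact .of_forall fun x => rfl
  · have hinv' (θ : ℝ) : act (planeRotation (.inr i) (.inr j) θ) F = F := by
      obtain ⟨S, hS⟩ := exists_reservoirRotation_eq (M := M) hij θ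
      rw [← hS, hinv]
    filter_upwards [inner_rotField_ae_eq_zero hr (by simpa using hij) hinv' hG] with x hx
    rw [rotField, inner_sub_left, real_inner_smul_left, real_inner_smul_left,
      EuclideanSpace.inner_single_left, EuclideanSpace.inner_single_left] at hx
    simpa [sub_eq_zero] using hx

end Invariant

/-! ### Fisher information as a supremum of linear functionals -/

section Dual

variable {ι : Type*} [Fintype ι] {r : ℝ}

/-- Truncations of `G / F`. -/
def truncatedQuotient (F : EuclideanSpace ℝ ι → ℝ) (G : EuclideanSpace ℝ ι → EuclideanSpace ℝ ι)
    (n : ℕ) (x : EuclideanSpace ℝ ι) : EuclideanSpace ℝ ι :=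
  (if ‖G x‖ ≤ n then (max (F x) 0 + 1 / ((n : ℝ) + 1))⁻¹ else 0) • G x

theorem max_add_pos (a : ℝ) (n : ℕ) : 0 < max a 0 + 1 / ((n : ℝ) + 1) :=
  add_pos_of_nonneg_of_pos (le_max_right _ _) (by positivity)

theorem measurable_truncatedQuotient {F : EuclideanSpace ℝ ι → ℝ}
    {G : EuclideanSpace ℝ ι → EuclideanSpace ℝ ι} (hF : Measurable F) (hG : Measurable G) (n : ℕ) :
    Measurable (truncatedQuotient F G n) := by
  have h : Measurable fun x =>
      if ‖G x‖ ≤ n then (max (F x) 0 + 1 / ((n : ℝ) + 1))⁻¹ else 0 :=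
    Measurable.ite (measurableSet_le hG.norm measurable_const)
      ((hF.max measurable_const).add_const _).inv measurable_const
  exact h.smul hG

theorem norm_truncatedQuotient_le (F : EuclideanSpace ℝ ι → ℝ)
    (G : EuclideanSpace ℝ ι → EuclideanSpace ℝ ι) (n : ℕ) (x : EuclideanSpace ℝ ι) :
    ‖truncatedQuotient F G n x‖ ≤ (n + 1) * n := by
  unfold truncatedQuotient
  split_ifs with h
  · rw [norm_smul, Real.norm_of_nonneg (inv_nonneg.2 (max_add_pos _ _).le)]
    refine mul_le_mul ?_ h (norm_nonneg _) (by positivity)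
    refine inv_le_of_inv_le₀ (by positivity) ?_
    rw [← one_div]
    exact le_add_of_nonneg_left (le_max_right _ _)
  · rw [zero_smul, norm_zero]
    positivity

/-- The regularized denominator is at least `F`, so `‖h‖² F ≤ h·G` for the truncation `h`. -/
theorem le_truncatedQuotient (F : EuclideanSpace ℝ ι → ℝ)
    (G : EuclideanSpace ℝ ι → EuclideanSpace ℝ ι) (n : ℕ) (x : EuclideanSpace ℝ ι) :
    inner ℝ (truncatedQuotient F G n x) (G x) ≤
      inner ℝ ((2 : ℝ) • truncatedQuotient F G n x) (G x) +
        -‖truncatedQuotient F G n x‖ ^ 2 * F x := by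
  unfold truncatedQuotient
  split_ifs with h
  · set f := max (F x) 0 + 1 / ((n : ℝ) + 1)
    have hf : 0 < f := max_add_pos _ _
    have hle : F x ≤ f := (le_max_left _ _).trans (le_add_of_nonneg_right (by positivity))
    rw [real_inner_smul_left, real_inner_smul_left, real_inner_smul_left, norm_smul, mul_pow,
      Real.norm_of_nonneg (inv_nonneg.2 hf.le), real_inner_self_eq_norm_sq]
    have : f⁻¹ ^ 2 * ‖G x‖ ^ 2 * F x ≤ f⁻¹ * ‖G x‖ ^ 2 := by
      calc f⁻¹ ^ 2 * ‖G x‖ ^ 2 * F x ≤ f⁻¹ ^ 2 * ‖G x‖ ^ 2 * f := by gcongr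
        _ = f⁻¹ * ‖G x‖ ^ 2 := by field_simp
    linarith
  · simp

theorem inner_truncatedQuotient_nonneg (F : EuclideanSpace ℝ ι → ℝ)
    (G : EuclideanSpace ℝ ι → EuclideanSpace ℝ ι) (n : ℕ) (x : EuclideanSpace ℝ ι) :
    0 ≤ inner ℝ (truncatedQuotient F G n x) (G x) := by
  unfold truncatedQuotient
  rw [real_inner_smul_left, real_inner_self_eq_norm_sq]
  split_ifs
  · exact mul_nonneg (inv_nonneg.2 (max_add_pos _ _).le) (sq_nonneg _)
  · simp

open Filter Topology in
theorem tendsto_inner_truncatedQuotient (F : EuclideanSpace ℝ ι → ℝ)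
    (G : EuclideanSpace ℝ ι → EuclideanSpace ℝ ι) (x : EuclideanSpace ℝ ι) :
    Tendsto (fun n => ENNReal.ofReal (inner ℝ (truncatedQuotient F G n x) (G x))) atTop
      (𝓝 (‖G x‖ₑ ^ 2 / ENNReal.ofReal (F x))) := by
  have h1 : Tendsto (fun n : ℕ => ENNReal.ofReal (max (F x) 0 + 1 / ((n : ℝ) + 1))) atTop
      (𝓝 (ENNReal.ofReal (F x))) := by
    have := (tendsto_one_div_add_atTop_nhds_zero_nat (𝕜 := ℝ)).const_add (max (F x) 0)
    rw [add_zero] at this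
    have h := (ENNReal.continuous_ofReal.tendsto _).comp this
    have e : ENNReal.ofReal (max (F x) 0) = ENNReal.ofReal (F x) := by
      rcases le_total (F x) 0 with h | h
      · rw [max_eq_right h, ENNReal.ofReal_zero, ENNReal.ofReal_of_nonpos h]
      · rw [max_eq_left h]
    rw [e] at h
    exact h
  have h2 := ENNReal.Tendsto.const_div (a := ‖G x‖ₑ ^ 2) h1 (.inr (by finiteness))
  refine h2.congr' ?_
  filter_upwards [eventually_ge_atTop ⌈‖G x‖⌉₊] with n hn
  rw [truncatedQuotient, if_pos (Nat.ceil_le.1 hn), real_inner_smul_left,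
    real_inner_self_eq_norm_sq, mul_comm, ← div_eq_mul_inv,
    ENNReal.ofReal_div_of_pos (max_add_pos _ _), ENNReal.ofReal_pow (norm_nonneg _),
    ofReal_norm]

open Filter in
-- Fatou's lemma along the truncations. No sign of `F` is needed: where `F ≤ 0` the limit is `0` or
-- `∞`, in agreement with division by `0` in `[0, ∞]`. Positivity of the evolved density thus never
-- has to be shown.
theorem lintegral_le_of_truncatedQuotient {F : EuclideanSpace ℝ ι → ℝ}
    {G : EuclideanSpace ℝ ι → EuclideanSpace ℝ ι} (hF : Measurable F) (hG : Measurable G)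
    (hFi : Integrable F (sphereMeasure ι r)) (hGi : Integrable G (sphereMeasure ι r)) {C : ℝ}
    (h : ∀ n, ∫ x, inner ℝ ((2 : ℝ) • truncatedQuotient F G n x) (G x) ∂(sphereMeasure ι r) +
      ∫ x, -‖truncatedQuotient F G n x‖ ^ 2 * F x ∂(sphereMeasure ι r) ≤ C) :
    ∫⁻ x, ‖G x‖ₑ ^ 2 / ENNReal.ofReal (F x) ∂(sphereMeasure ι r) ≤ ENNReal.ofReal C := by
  have hm (n) := measurable_truncatedQuotient hF hG n
  have hb (n : ℕ) : ∀ᵐ x ∂(sphereMeasure ι r), ‖truncatedQuotient F G n x‖ ≤ (n + 1) * n :=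
    .of_forall (norm_truncatedQuotient_le F G n)
  have hi (n : ℕ) := integrable_inner_field (hm n).aestronglyMeasurable (hb n) hGi
  have hle (n : ℕ) : ∫⁻ x, ENNReal.ofReal (inner ℝ (truncatedQuotient F G n x) (G x))
      ∂(sphereMeasure ι r) ≤ ENNReal.ofReal C := by
    rw [← ofReal_integral_eq_lintegral_ofReal (hi n)
      (.of_forall (inner_truncatedQuotient_nonneg F G n))]
    refine ENNReal.ofReal_le_ofReal (le_trans ?_ (h n))
    have h1 : Integrable (fun x => inner ℝ ((2 : ℝ) • truncatedQuotient F G n x) (G x))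
        (sphereMeasure ι r) := by
      simpa only [real_inner_smul_left] using (hi n).const_mul 2
    have h2 : Integrable (fun x => -‖truncatedQuotient F G n x‖ ^ 2 * F x)
        (sphereMeasure ι r) := by
      refine integrable_mul_fun (C := (((n : ℝ) + 1) * n) ^ 2)
        ((hm n).norm.pow_const 2).neg.aestronglyMeasurable (.of_forall fun x => ?_) hFi
      rw [norm_neg, norm_pow, norm_norm]
      exact pow_le_pow_left₀ (norm_nonneg _) (norm_truncatedQuotient_le F G n x) 2
    rw [← integral_add h1 h2]
    exact integral_mono (hi n) (h1.add h2) (le_truncatedQuotient F G n)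
  calc ∫⁻ x, ‖G x‖ₑ ^ 2 / ENNReal.ofReal (F x) ∂(sphereMeasure ι r)
      = ∫⁻ x, liminf (fun n => ENNReal.ofReal (inner ℝ (truncatedQuotient F G n x) (G x))) atTop
          ∂(sphereMeasure ι r) :=
        lintegral_congr fun x => (tendsto_inner_truncatedQuotient F G x).liminf_eq.symm
    _ ≤ liminf (fun n => ∫⁻ x, ENNReal.ofReal (inner ℝ (truncatedQuotient F G n x) (G x))
          ∂(sphereMeasure ι r)) atTop :=
        lintegral_liminf_le fun n => ((hm n).inner hG).ennreal_ofReal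
    _ ≤ ENNReal.ofReal C :=
        liminf_le_of_le (by isBoundedDefault) fun b hb =>
          hb.exists.elim fun n hn => hn.trans (hle n)

end Dual

/-! ### The bound on the information of the marginal -/

section Main

theorem IsWeakGradient.congr {ι : Type*} [Fintype ι] [DecidableEq ι] {r : ℝ}
    {F : EuclideanSpace ℝ ι → ℝ} {G G' : EuclideanSpace ℝ ι → EuclideanSpace ℝ ι}
    (h : IsWeakGradient r F G) (hG : G =ᵐ[sphereMeasure ι r] G') : IsWeakGradient r F G' where
  integrable := h.integrable.congr hG
  tangent := by
    filter_upwards [h.tangent, hG] with x h1 h2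
    rw [← h2, h1]
  integral_eq i j φ hφ := by
    rw [h.integral_eq i j φ hφ]
    refine congrArg _ (integral_congr_ae ?_)
    filter_upwards [hG] with x hx
    rw [hx]

variable {M N : ℕ}

/-- The marginal of the evolved density has a weak gradient, and its information is at most
`2 (M/(M+N) + e N/(M+N))` times that of the initial density, which need not be invariant under
rotations of the reservoir. -/
theorem lintegral_marginalPair_le {lamS lamR mu : ℝ} (hM : 1 ≤ M) (hN : 1 ≤ N) (hlamS : 0 ≤ lamS)
    (hlamR : 0 ≤ lamR) (hmu : 0 ≤ mu) {ν : Measure ℝ} [IsProbabilityMeasure ν]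
    (hν : ∫ θ, Real.sin θ * Real.cos θ ∂ν = 0) {r : ℝ} (hr : 0 < r)
    {y : PairL1 (Particles M N) r} (hy : y ∈ weakGradients hr.le)
    (hF : ∀ᵐ x ∂(sphereMeasure (Particles M N) r), 0 ≤ y.1 x)
    (hfin : ∫⁻ x, ‖y.2 x‖ₑ ^ 2 / ENNReal.ofReal (y.1 x) ∂(sphereMeasure (Particles M N) r) ≠ ⊤)
    {t : ℝ} (ht : 0 ≤ t) {e : ℝ}
    (he : Real.exp (-(mu * (∫ θ, Real.sin θ ^ 2 ∂ν) * ((M + N : ℝ) / N) * t)) = e)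
    {z : PairL1 (Particles M N) r}
    (hz : z = marginalPair (NormedSpace.exp (t • generatorPair M N lamS lamR mu ν r) y)) :
    z ∈ weakGradients hr.le ∧
    ∫⁻ x, ‖z.2 x‖ₑ ^ 2 / ENNReal.ofReal (z.1 x) ∂(sphereMeasure (Particles M N) r) ≤
      ENNReal.ofReal (2 * (M / (M + N) + e * (N / (M + N)))) *
        ∫⁻ x, ‖y.2 x‖ₑ ^ 2 / ENNReal.ofReal (y.1 x) ∂(sphereMeasure (Particles M N) r) := by
  have hFm : AEStronglyMeasurable y.1 (sphereMeasure (Particles M N) r) :=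
    Lp.aestronglyMeasurable _
  have hGm : AEStronglyMeasurable y.2 (sphereMeasure (Particles M N) r) :=
    Lp.aestronglyMeasurable _
  -- Finite information makes the integrand finite almost everywhere, which excludes a nonzero
  -- gradient over a zero of the function.
  have hzero : ∀ᵐ x ∂(sphereMeasure (Particles M N) r), y.1 x = 0 → y.2 x = 0 := by
    have hm : AEMeasurable (fun x => ‖y.2 x‖ₑ ^ 2 / ENNReal.ofReal (y.1 x))
        (sphereMeasure (Particles M N) r) :=
      (hGm.enorm.pow_const 2).div hFm.aemeasurable.ennreal_ofReal
    filter_upwards [ae_lt_top' hm hfin] with x hx h0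
    by_contra hne
    rw [h0, ENNReal.ofReal_zero, ENNReal.div_zero (by simpa using hne)] at hx
    exact lt_irrefl _ hx
  have heq : ∀ᵐ x ∂(sphereMeasure (Particles M N) r), ‖y.2 x‖ₑ ^ 2 / ENNReal.ofReal (y.1 x) =
      ENNReal.ofReal (‖y.2 x‖ ^ 2 / y.1 x) := by
    filter_upwards [hF, hzero] with x hx hx0
    rcases hx.eq_or_lt with h0 | hpos
    · simp [hx0 h0.symm]
    · rw [ENNReal.ofReal_div_of_pos hpos, ENNReal.ofReal_pow (norm_nonneg _),
        ofReal_norm]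
  have hpos : 0 ≤ᵐ[sphereMeasure (Particles M N) r] fun x => ‖y.2 x‖ ^ 2 / y.1 x := by
    filter_upwards [hF] with x hx
    exact div_nonneg (sq_nonneg _) hx
  have hI : Integrable (fun x => ‖y.2 x‖ ^ 2 / y.1 x) (sphereMeasure (Particles M N) r) := by
    refine ⟨(hGm.norm.pow 2).div₀ hFm, ?_⟩
    rw [hasFiniteIntegral_iff_ofReal hpos, ← lintegral_congr_ae heq]
    exact hfin.lt_top
  rw [lintegral_congr_ae heq, ← ofReal_integral_eq_lintegral_ofReal hI hpos]
  obtain ⟨b, hb⟩ := exists_fisherForm hr hFm hGm hI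
  have htr := fisherForm_trace hr hFm hGm hI hb
  set J := ∫ x, ‖y.2 x‖ ^ 2 / y.1 x ∂(sphereMeasure (Particles M N) r)
  have hrow (a : Particles M N) : 0 ≤ rowForm b 1 a := by
    rw [rowForm, hb]
    refine integral_nonneg_of_ae ?_
    filter_upwards [hF] with x hx
    refine div_nonneg ?_ hx
    rw [fisherDensity, ← sq, ← sq]
    positivity
  have hzW : z ∈ weakGradients hr.le := by
    rw [hz]
    refine average_mem _ _ (isClosed_weakGradients hr.le)
      (fun g _ => push_mem_weakGradients hr.le g) (exp_apply_mem (isClosed_weakGradients hr.le)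
        (fun x hx => smul_generatorPair_mem hr.le hx t) hy)
  have hpar := parallel_of_invariant hr.le (F := z.1) (G := z.2) (fun S => by
    rw [← push_fst, hz, push_marginalPair]) hzW
  have hα : (0 : ℝ) ≤ 2 * (M / (M + N) + e * (N / (M + N))) := by
    rw [← he]
    positivity
  refine ⟨hzW, ?_⟩
  rw [← ENNReal.ofReal_mul hα]
  refine lintegral_le_of_truncatedQuotient (Lp.stronglyMeasurable _).measurable
    (Lp.stronglyMeasurable _).measurable (L1.integrable_coeFn _) (L1.integrable_coeFn _)
    fun n => ?_
  -- The test field is a pointwise multiple of the gradient of `z`, hence inherits its parallel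
  -- reservoir part.
  set q := truncatedQuotient z.1 z.2 n with hq
  have hqm : Measurable q := measurable_truncatedQuotient (Lp.stronglyMeasurable _).measurable
    (Lp.stronglyMeasurable _).measurable n
  have hqb (x) : ‖q x‖ ≤ (n + 1) * n := norm_truncatedQuotient_le _ _ n x
  have hqpar : ∀ᵐ x ∂(sphereMeasure (Particles M N) r), ∀ i j : Fin N,
      x (.inr i) * q x (.inr j) = x (.inr j) * q x (.inr i) := by
    filter_upwards [hpar] with x hx i j
    simp only [hq, truncatedQuotient, PiLp.smul_apply, smul_eq_mul]
    linear_combination (if ‖z.2 x‖ ≤ n then (max (z.1 x) 0 + 1 / ((n : ℝ) + 1))⁻¹ else 0) * hx i j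
  obtain ⟨l, hl⟩ := exists_functional (r := r) (h := fun x => (2 : ℝ) • q x)
    (k := fun x => -‖q x‖ ^ 2) (C := 2 * ((n + 1) * n)) (D := ((n + 1) * n) ^ 2)
    (hqm.const_smul (2 : ℝ)).aestronglyMeasurable (.of_forall fun x => by
      rw [norm_smul, Real.norm_two]
      exact mul_le_mul_of_nonneg_left (hqb x) zero_le_two)
    (hqm.norm.pow_const 2).neg.aestronglyMeasurable (.of_forall fun x => by
      rw [norm_neg, norm_pow, norm_norm]
      exact pow_le_pow_left₀ (norm_nonneg _) (hqb x) 2)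
  have hbase (g) : l (push g y) ≤ ∑ i : Fin M, rowForm b g (.inl i) :=
    functional_push_le hr hF hzero hI (mem_weakGradients.1 hy).tangent hb
      hqm.aestronglyMeasurable hqb hqpar hl g
  -- The average over the reservoir costs nothing: its rotations fix the system basis vectors, and
  -- so the right-hand side.
  have hmarg (g) : (l.comp marginalPair) (push g y) ≤ ∑ i : Fin M, rowForm b g (.inl i) := by
    rw [ContinuousLinearMap.comp_apply, marginalPair, apply_average]
    refine (integral_mono (l.integrable_comp (integrable_push _ continuous_reservoirRotation _))
      (integrable_const (∑ i : Fin M, rowForm b g (.inl i))) fun S => ?_).trans_eq (by simp)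
    change l (push (reservoirRotation S) (push g y)) ≤ _
    rw [← push_mul]
    refine (hbase _).trans_eq (Finset.sum_congr rfl fun i _ => ?_)
    exact rowForm_reservoirRotation_mul b S g i
  have key := apply_exp_generatorPair_le (lamS := lamS) (lamR := lamR) hM hN hlamS hlamR hmu hν
    hmarg ht he
  rw [ContinuousLinearMap.comp_apply, ← hz, hl] at key
  refine key.trans ?_
  have hP : ∑ i : Fin M, rowForm b 1 (.inl i) + ∑ j : Fin N, rowForm b 1 (.inr j) = 2 * J := by
    rw [← htr, Fintype.sum_sum_type]
    simp only [rowForm, inv_one, rot_one_apply]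
  have hQ : 0 ≤ ∑ j : Fin N, rowForm b 1 (.inr j) := Finset.sum_nonneg fun j _ => hrow _
  have he0 : 0 ≤ e := he ▸ Real.exp_nonneg _
  have hc : (0 : ℝ) ≤ e * (N / (M + N)) + e * (M / (M + N)) := by positivity
  -- The reservoir weight is smaller by `e` and is raised to the system weight, which produces the
  -- full trace `2 * J`.
  calc _ ≤ (M / (M + N) + e * (N / (M + N))) * ∑ i : Fin M, rowForm b 1 (.inl i) +
        (M / (M + N) + e * (N / (M + N))) * ∑ j : Fin N, rowForm b 1 (.inr j) := by
        gcongr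
        linarith
    _ = 2 * (M / (M + N) + e * (N / (M + N))) * J := by
        rw [← mul_add, hP]
        ring

end Main

end

end Kac

/-! ### The theorem for states -/

open Kac in
theorem theorem3 (M N : ℕ) (hM : 1 ≤ M) (hN : 1 ≤ N)
    (lamS lamR mu : ℝ) (hlamS : 0 ≤ lamS) (hlamR : 0 ≤ lamR) (hmu : 0 ≤ mu)
    (ν : MeasureTheory.Measure ℝ) [MeasureTheory.IsProbabilityMeasure ν]
    (hν : ∫ θ, Real.sin θ * Real.cos θ ∂ν = 0)
    (F₀ : Kac.State M N) (hF₀ : 0 ≤ F₀)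
    (hinv : ∀ S : Matrix.specialOrthogonalGroup (Fin N) ℝ,
      Kac.act (Kac.reservoirRotation S) F₀ = F₀)
    (t : ℝ) (ht : 0 ≤ t) :
    Kac.information (Kac.marginal (Kac.evolution M N lamS lamR mu ν t F₀)) ≤
      ENNReal.ofReal
        (2 * ((M : ℝ) / (M + N) +
            Real.exp (-(mu * (∫ θ, Real.sin θ ^ 2 ∂ν) * ((M + N : ℝ) / N) * t)) *
              ((N : ℝ) / (M + N))) +
          (M : ℝ) / N) *
        Kac.information F₀ := by
  have hM0 : (0 : ℝ) < M := by exact_mod_cast hM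
  have hN0 : (0 : ℝ) < N := by exact_mod_cast hN
  have hr : 0 < Real.sqrt (M + N) := Real.sqrt_pos.2 (by positivity)
  have hc : ENNReal.ofReal (2 * ((M : ℝ) / (M + N) +
      Real.exp (-(mu * (∫ θ, Real.sin θ ^ 2 ∂ν) * ((M + N : ℝ) / N) * t)) *
        ((N : ℝ) / (M + N))) + (M : ℝ) / N) ≠ 0 := by
    rw [Ne, ENNReal.ofReal_eq_zero, not_le]
    positivity
  unfold information
  conv_rhs => rw [fisherInformation]
  rw [ENNReal.mul_iInf_of_ne hc ENNReal.ofReal_ne_top]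
  refine le_iInf fun G => ?_
  rw [ENNReal.mul_iInf_of_ne hc ENNReal.ofReal_ne_top]
  refine le_iInf fun hG => ?_
  by_cases hfin : ∫⁻ x, ‖G x‖ₑ ^ 2 / ENNReal.ofReal (F₀ x)
      ∂(sphereMeasure (Particles M N) (Real.sqrt (M + N))) = ⊤
  · rw [hfin, ENNReal.mul_top hc]
    exact le_top
  have hGL := hG.integrable.coeFn_toL1
  have hJ : ∫⁻ x, ‖hG.integrable.toL1 G x‖ₑ ^ 2 / ENNReal.ofReal (F₀ x)
      ∂(sphereMeasure (Particles M N) (Real.sqrt (M + N))) =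
      ∫⁻ x, ‖G x‖ₑ ^ 2 / ENNReal.ofReal (F₀ x)
      ∂(sphereMeasure (Particles M N) (Real.sqrt (M + N))) := by
    refine lintegral_congr_ae ?_
    filter_upwards [hGL] with x hx
    rw [hx]
  -- The pair evolution may start from any weak gradient of `F₀`; its function component is the
  -- evolution of `F₀` alone.
  have hexp : (marginalPair (NormedSpace.exp
      (t • generatorPair M N lamS lamR mu ν (Real.sqrt (M + N)))
        ((F₀, hG.integrable.toL1 G) : PairL1 (Particles M N) (Real.sqrt (M + N))))).1 =
      marginal (evolution M N lamS lamR mu ν t F₀) := by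
    rw [marginalPair_fst]
    congr 1
    refine map_exp_apply (ContinuousLinearMap.fst ℝ (State M N)
      (FieldL1 (Particles M N) (Real.sqrt (M + N)))) (fun y => ?_) _
    exact congrArg (t • ·) (generatorPair_fst lamS lamR mu ν y)
  obtain ⟨hW, hle⟩ := lintegral_marginalPair_le (lamS := lamS) (lamR := lamR) hM hN hlamS hlamR
    hmu hν hr (y := (F₀, hG.integrable.toL1 G)) (hG.congr hGL.symm) (Lp.coeFn_nonneg F₀ |>.2 hF₀)
    (by rwa [hJ]) ht rfl rfl
  rw [mem_weakGradients] at hW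
  rw [hexp] at hW hle
  rw [fisherInformation]
  refine (iInf₂_le _ hW).trans (hle.trans ?_)
  rw [hJ]
  gcongr
  -- The bound obtained has no term `M / N`; it is added here.
  exact le_add_of_nonneg_right (by positivity)
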